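/- \textbf{Setting.} Let $G\le GL_n(\mathbb C)$ be a connected closed subgroup, $\mathfrak g=\{X\in M_n(\mathbb C): \exp(tX)\in G\ \forall t\in\mathbb R\}$ its Lie algebra, and $g_1,\dots,g_{N_{\dim}}\in\mathfrak g$ elements that generate $\mathfrak g$ as a real Lie algebra (for instance a basis). Let $\mathbb K\in\{\mathbb R,\mathbb C\}$, let $\mathbb F$ be a field containing $\mathbb K$ (for instance $\mathbb F=\mathbb K$), and let $G$ act on a set $\Omega$. Let $\mathcal L$ be an index set and, for $l\in\mathcal L$, let $\mathcal M_l$ be a finite set and $\phi^l_m:\Omega\to\mathbb F$ $(m\in\mathcal M_l)$ functions such that the whole family $(\phi^l_m)_{l\in\mathcal L,\,m\in\mathcal M_l}$ is linearly independent over $\mathbb F$ (for instance orthonormal for an $\mathbb F$-valued scalar product). Let $\rho^l:G\to GL(\mathbb K^{\mathcal M_l})$ be continuous representations with $$\phi^l_m(g\cdot r)=\sum_{m'\in\mathcal M_l}\rho^l_{m,m'}(g)\,\phi^l_{m'}(r)\qquad(g\in G,\ r\in\Omega),$$ and put $\rho^{l,d}=\frac{d}{dt}\big|_{t=0}\rho^l(\exp(tg_d))$.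 Let $\boldsymbol l=(l_1,\dots,l_N)\in\mathcal L^N$ and $L\in\mathcal L$. Let $\mathcal M_{\boldsymbol l}=\prod_i\mathcal M_{l_i}$, and let $\overline{\mathcal M}_{\boldsymbol l}$ be the set of classes of $\mathcal M_{\boldsymbol l}$ under permutations of the positions $1,\dots,N$ that fix $\boldsymbol l$. For $\boldsymbol m\in\overline{\mathcal M}_{\boldsymbol l}$, a value $v$ of $\boldsymbol l$ and $p\in\mathcal M_v$, let $\lambda_{\boldsymbol m,v,p}=\#\{i: l_i=v,\ m_i=p\}$; these count vectors determine the class. For $p\neq q$ in $\mathcal M_v$ with $\lambda_{\boldsymbol m,v,p}>0$, let $\boldsymbol m_{(v,p,q)}$ be the class whose count vector is obtained from that of $\boldsymbol m$ by decreasing the entry $(v,p)$ by one and increasing the entry $(v,q)$ by one (the classes interacting with $\boldsymbol m$). Put $$\bar\phi^{l}_{m}(r_1,\dots,r_N)=\sum_{i=1}^N\phi^l_m(r_i),\qquad \bar\phi^{\boldsymbol l}_{\boldsymbol m}=\prod_{i=1}^N\bar\phi^{l_i}_{m_i},$$ which depends only on the class of $\boldsymbol m$, and $\bar V^{\boldsymbol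 l}=\mathrm{Span}_{\mathbb K}\{\bar\phi^{\boldsymbol l}_{\boldsymbol m}\}$. Let $\bar V^{\boldsymbol l,L}$ be the $\mathbb K$-vector space of all $F=(F_k)_{k\in\mathcal M_L}:\Omega^N\to\mathbb F^{\mathcal M_L}$ with all $F_k\in\bar V^{\boldsymbol l}$ that are GE-PI for $\rho^L$, i.e. $F(g\cdot r_{\sigma_1},\dots,g\cdot r_{\sigma_N})=\rho^L(g)F(r_1,\dots,r_N)$ for all $g\in G$, $(r_i)\in\Omega^N$, $\sigma\in S_N$. \textbf{Theorem.} Let $M^{\boldsymbol l,L}$ be the matrix obtained by stacking the blocks $M_1,\dots,M_{N_{\dim}}$ where, for $(\boldsymbol m,k),(\boldsymbol m',k')\in\overline{\mathcal M}_{\boldsymbol l}\times\mathcal M_L$, $$M_d[(\boldsymbol m,k),(\boldsymbol m',k')]=\begin{cases}\sum_{j=1}^N\rho^{l_j,d}_{m_j,m_j}-\rho^{L,d}_{k,k}&\boldsymbol m=\boldsymbol m',\ k=k',\\ -\rho^{L,d}_{k,k'}&\boldsymbol m=\boldsymbol m',\ k\ne k',\\ \lambda_{\boldsymbol m',v,q}\,\rho^{v,d}_{q,p}&\boldsymbol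 m'=\boldsymbol m_{(v,p,q)},\ k=k',\\ 0&\text{otherwise.}\end{cases}$$ For $c\in\mathbb K^{\overline{\mathcal M}_{\boldsymbol l}\times\mathcal M_L}$ put $F_c=\big[\sum_{\boldsymbol m\in\overline{\mathcal M}_{\boldsymbol l}}c_{\boldsymbol m,k}\,\bar\phi^{\boldsymbol l}_{\boldsymbol m}\big]_{k\in\mathcal M_L}$. Then: (i) $F_c\in\bar V^{\boldsymbol l,L}$ if and only if $c\in\ker M^{\boldsymbol l,L}$; (ii) if $c_1,\dots,c_D$ with $D=\dim\ker M^{\boldsymbol l,L}$ is a basis of $\ker M^{\boldsymbol l,L}$, then $F_{c_1},\dots,F_{c_D}$ is a basis of $\bar V^{\boldsymbol l,L}$; (iii) $\bar V^{\boldsymbol l,L}$ is finite-dimensional and $\dim_{\mathbb K}\bar V^{\boldsymbol l,L}=\dim_{\mathbb K}\ker M^{\boldsymbol l,L}$. -/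

import Mathlib

open scoped BigOperators MatrixGroups

/-! ### Linear Lie groups: exponential, Lie algebra, derivative of a representation -/

section LieGroup

variable {n : ℕ}

/-- The matrix exponential, as an element of `GL_n(ℂ)`. -/
noncomputable def glExp (X : Matrix (Fin n) (Fin n) ℂ) : GL (Fin n) ℂ :=
  (Matrix.isUnit_exp X).unit

/-- The Lie algebra of a linear group `G ≤ GL_n(ℂ)`: all `X` with `exp (t X) ∈ G` for every
real `t`. -/
def linLieAlgebra (G : Subgroup (GL (Fin n) ℂ)) : Set (Matrix (Fin n) (Fin n) ℂ) :=
  {X | ∀ t : ℝ, glExp (t • X) ∈ G}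

/-- The derivative `dρ(X) = d/dt|_{t=0} ρ(exp (t X))` of a matrix representation, entrywise. -/
noncomputable def repDeriv {𝕜 : Type*} [RCLike 𝕜] {G : Subgroup (GL (Fin n) ℂ)}
    {κ : Type*} [Fintype κ] [DecidableEq κ]
    (ρ : G →* Matrix κ κ 𝕜) (X : linLieAlgebra G) : Matrix κ κ 𝕜 :=
  Matrix.of fun a b => deriv (fun t : ℝ => ρ ⟨glExp (t • X.1), X.2 t⟩ a b) 0

/-- The elements `X d` generate the Lie algebra of `G`: every real subspace of `M_n(ℂ)` that
contains them and is closed under the commutator contains the Lie algebra of `G`. -/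
def GeneratesLieAlgebra {G : Subgroup (GL (Fin n) ℂ)} {ι : Type*} (X : ι → linLieAlgebra G) :
    Prop :=
  ∀ W : Submodule ℝ (Matrix (Fin n) (Fin n) ℂ), (∀ d, (X d).1 ∈ W) →
    (∀ A ∈ W, ∀ B ∈ W, A * B - B * A ∈ W) → ∀ Y ∈ linLieAlgebra G, Y ∈ W

end LieGroup

/-! ### Multi-indices, orbit classes and count vectors -/

section Classes

variable {𝓛 : Type*} {M : 𝓛 → Type*} {N : ℕ}

/-- The index set `M_l = ∏ M_{l_i}` for `l ∈ 𝓛^N`. -/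
abbrev MultiIndex (M : 𝓛 → Type*) (l : Fin N → 𝓛) : Type _ := ∀ i, M (l i)

/-- The pairs `(l_i, m_i)`. -/
def pairAt {l : Fin N → 𝓛} (m : MultiIndex M l) (i : Fin N) : Σ v, M v := ⟨l i, m i⟩

/-- `m ∼ m'` iff `m' = π m` for a permutation `π` with `π l = l`. Equality of the entries, which
live in the types `M (l i)` and `M (l (π i))` with `l (π i) = l i`, is equality of pairs. -/
def orbitSetoid (M : 𝓛 → Type*) (l : Fin N → 𝓛) : Setoid (MultiIndex M l) where
  r m m' := ∃ π : Equiv.Perm (Fin N), (∀ i, l (π i) = l i) ∧ ∀ i, pairAt m' i = pairAt m (π i)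
  iseqv :=
    { refl := fun _ => ⟨1, fun _ => rfl, fun _ => rfl⟩
      symm := by
        rintro m m' ⟨π, h1, h2⟩
        refine ⟨π⁻¹, fun i => ?_, fun i => ?_⟩
        · simpa using (h1 (π⁻¹ i)).symm
        · simpa using (h2 (π⁻¹ i)).symm
      trans := by
        rintro m m' m'' ⟨π, h1, h2⟩ ⟨τ, h3, h4⟩
        refine ⟨π * τ, fun i => ?_, fun i => ?_⟩
        · simpa using (h1 (τ i)).trans (h3 i)
        · simpa using (h4 i).trans (h2 (τ i)) }

/-- The set of classes `M̄_l`. -/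
def OrbitClass (M : 𝓛 → Type*) (l : Fin N → 𝓛) : Type _ := Quotient (orbitSetoid M l)

noncomputable instance [∀ v, Fintype (M v)] (l : Fin N → 𝓛) : Fintype (OrbitClass M l) :=
  letI : Finite (OrbitClass M l) := Quotient.finite _
  Fintype.ofFinite _

noncomputable instance (l : Fin N → 𝓛) : DecidableEq (OrbitClass M l) := Classical.decEq _

/-- The count vector of a class: the number of `i` with `l_i = s.1` and `m_i = s.2`. Its blocks are
indexed by the distinct values `v` of `l`, and the block of `v` is `p ↦ countVec m ⟨v, p⟩`. -/
noncomputable def countVec {l : Fin N → 𝓛} (m : OrbitClass M l) (s : Σ v, M v) : ℕ :=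
  Quotient.lift (fun m : MultiIndex M l => Nat.card {i : Fin N // pairAt m i = s})
    (by
      rintro m m' ⟨π, -, h⟩
      refine (Nat.card_congr (π.subtypeEquiv fun i => ?_)).symm
      rw [h i]) m

/-- `m' = m_{(v,p,q)}` is the class interacting with `m` whose count vector is
`λ_m - e_p + e_q` (in the block of the value `v` of `l`), where `p ≠ q` and `λ_{m,p} > 0`. -/
def IsInteracting {l : Fin N → 𝓛} (m m' : OrbitClass M l) (v : 𝓛) (p q : M v) : Prop :=
  p ≠ q ∧ 0 < countVec m ⟨v, p⟩ ∧
    ∀ s : Σ v, M v, (countVec m' s : ℤ) =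
      countVec m s - Set.indicator {(⟨v, p⟩ : Σ v, M v)} 1 s
        + Set.indicator {(⟨v, q⟩ : Σ v, M v)} 1 s

end Classes

/-! ### One-particle sums, the space `V̄^l` and the equivariant space `V̄^{l,L}` -/

section Functions

variable {𝓛 : Type*} {M : 𝓛 → Type*} {N : ℕ} {Ω 𝔽 : Type*} [Field 𝔽]

/-- `φ̄^v_p (r_1, …, r_N) = ∑ i, φ^v_p (r_i)`. -/
def oneParticleSum (φ : ∀ v, M v → Ω → 𝔽) (s : Σ v, M v) (R : Fin N → Ω) : 𝔽 :=
  ∑ i, φ s.1 s.2 (R i)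

/-- `φ̄^l_m = ∏ i, φ̄^{l_i}_{m_i}` for a multi-index `m`. -/
def prodSum (φ : ∀ v, M v → Ω → 𝔽) {l : Fin N → 𝓛} (m : MultiIndex M l)
    (R : Fin N → Ω) : 𝔽 :=
  ∏ i, oneParticleSum φ (pairAt m i) R

/-- `φ̄^l_m` for a class `m` of multi-indices. -/
def classProdSum (φ : ∀ v, M v → Ω → 𝔽) {l : Fin N → 𝓛} (m : OrbitClass M l) :
    (Fin N → Ω) → 𝔽 :=
  Quotient.lift (fun m : MultiIndex M l => prodSum φ m)
    (by
      rintro m m' ⟨π, -, h⟩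
      funext R
      simp only [prodSum, h]
      exact (Equiv.prod_comp π fun i => oneParticleSum φ (pairAt m i) R).symm) m

/-- The space `V̄^l` spanned by the functions `φ̄^l_m`, `m ∈ M_l`. -/
def permInvSpace (𝕜 : Type*) [Field 𝕜] [Algebra 𝕜 𝔽] (φ : ∀ v, M v → Ω → 𝔽)
    (l : Fin N → 𝓛) : Submodule 𝕜 ((Fin N → Ω) → 𝔽) :=
  Submodule.span 𝕜 (Set.range fun m : MultiIndex M l => prodSum φ m)

/-- `F : Ω^N → 𝔽^κ` is group-equivariant for the representation `ρ` and permutation-invariant: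
`F (g · R_σ) = ρ(g) F(R)` for all `R`, `g`, `σ`. -/
def IsGEPI {𝕜 : Type*} [Field 𝕜] [Algebra 𝕜 𝔽] {G : Type*} [Group G] [MulAction G Ω]
    {κ : Type*} [Fintype κ] [DecidableEq κ] (ρ : G →* Matrix κ κ 𝕜)
    (F : (Fin N → Ω) → κ → 𝔽) : Prop :=
  ∀ (R : Fin N → Ω) (g : G) (σ : Equiv.Perm (Fin N)) (k : κ),
    F (fun i => g • R (σ i)) k = ∑ k', ρ g k k' • F R k'

/-- The space `V̄^{l,L}` of the GE-PI functions for `ρ` all of whose components lie in `V̄^l`. -/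
def gepiSpace {𝕜 : Type*} [Field 𝕜] [Algebra 𝕜 𝔽] {G : Type*} [Group G] [MulAction G Ω]
    (φ : ∀ v, M v → Ω → 𝔽) (l : Fin N → 𝓛)
    {κ : Type*} [Fintype κ] [DecidableEq κ] (ρ : G →* Matrix κ κ 𝕜) :
    Submodule 𝕜 ((Fin N → Ω) → κ → 𝔽) where
  carrier := {F | (∀ k, (fun R => F R k) ∈ permInvSpace 𝕜 φ l) ∧ IsGEPI ρ F}
  zero_mem' := ⟨fun _ => Submodule.zero_mem _, fun R g σ k => by simp⟩
  add_mem' := by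
    rintro F F' ⟨h1, h2⟩ ⟨h3, h4⟩
    refine ⟨fun k => Submodule.add_mem _ (h1 k) (h3 k), fun R g σ k => ?_⟩
    simp [h2 R g σ k, h4 R g σ k, Finset.sum_add_distrib]
  smul_mem' := by
    rintro a F ⟨h1, h2⟩
    refine ⟨fun k => Submodule.smul_mem _ a (h1 k), fun R g σ k => ?_⟩
    simp [h2 R g σ k, Finset.smul_sum, smul_comm a]

/-- The function `[∑ m, c_{m,k} φ̄^l_m]_k` with coefficients `c`, where `m` runs over the
classes. -/
noncomputable def coeffFun {𝕜 : Type*} [Field 𝕜] [Algebra 𝕜 𝔽] [∀ v, Fintype (M v)]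
    (φ : ∀ v, M v → Ω → 𝔽) {l : Fin N → 𝓛} {κ : Type*}
    (c : OrbitClass M l × κ → 𝕜) : (Fin N → Ω) → κ → 𝔽 :=
  fun R k => ∑ m : OrbitClass M l, c (m, k) • classProdSum φ m R

end Functions

/-! ### The matrix `M^{l,L}` -/

section TheMatrix

variable {𝓛 : Type*} {M : 𝓛 → Type*} {N : ℕ} {𝕜 : Type*} [Field 𝕜]

/-- `∑ j, D^{l_j}_{m_j, m_j}`, for a family of matrices `D^v`. -/
def classTrace (D : ∀ v, Matrix (M v) (M v) 𝕜) {l : Fin N → 𝓛} (m : OrbitClass M l) : 𝕜 :=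
  Quotient.lift (fun m : MultiIndex M l => ∑ j, D (l j) (m j) (m j))
    (by
      rintro m m' ⟨π, -, h⟩
      let f : (Σ v, M v) → 𝕜 := fun s => D s.1 s.2 s.2
      change ∑ j, f (pairAt m j) = ∑ j, f (pairAt m' j)
      rw [Finset.sum_congr rfl fun i _ => congrArg f (h i)]
      exact (Equiv.sum_comp π fun j => f (pairAt m j)).symm) m

open Classical in
/-- The submatrix `M_d`, where `D v = dρ^v(X_d)`. In the third case the sum over the blocks `v` of
`l` (its distinct values) and over `p, q ∈ M_v` has the single term `λ_{m',q} D^v_{q,p}` if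
`m' = m_{(v,p,q)}` is a class interacting with `m` (the triple `(v,p,q)` is then unique), and
vanishes if `m'` does not interact with `m`. -/
noncomputable def gepiBlock [∀ v, Fintype (M v)] (D : ∀ v, Matrix (M v) (M v) 𝕜)
    (l : Fin N → 𝓛) (L : 𝓛) :
    Matrix (OrbitClass M l × M L) (OrbitClass M l × M L) 𝕜 :=
  Matrix.of fun a b =>
    if a.1 = b.1 then
      if a.2 = b.2 then classTrace D a.1 - D L a.2 a.2 else - D L a.2 b.2
    else if a.2 = b.2 then
      ∑ v ∈ Finset.univ.image l, ∑ p : M v, ∑ q : M v,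
        if IsInteracting a.1 b.1 v p q then (countVec b.1 ⟨v, q⟩ : 𝕜) * D v q p else 0
    else 0

/-- The matrix `M^{l,L}`: the blocks `M_d`, `d = 1, …, N_dim`, stacked on top of each other. -/
noncomputable def gepiMatrix [∀ v, Fintype (M v)] {ι : Type*}
    (D : ι → ∀ v, Matrix (M v) (M v) 𝕜) (l : Fin N → 𝓛) (L : 𝓛) :
    Matrix (ι × (OrbitClass M l × M L)) (OrbitClass M l × M L) 𝕜 :=
  Matrix.of fun a b => gepiBlock (D a.1) l L a.2 b

end TheMatrix

/-! Let Φ be the vector of the functions `classProdSum φ m`. Expanding the products gives Φ(gR) =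
T(g) Φ(R) with T(g) the `classAction` of the matrices ρ^v(g), and F_c = C Φ with C = `coeffMatrix
c`. Permutation invariance is automatic, so everything concerns equivariance, which is handled in
two steps.

Independence: the entries of Φ are linearly independent (`linearIndependent_prod_sum`), so F_c is
equivariant iff C T(g) = ρ^L(g) C for all g. To prove independence, choose points dual to
combinations of the one-particle functions. At configurations of N such points, these combinations
of one-particle sums become the entries of a count vector of total N. Products of N linear forms
then separate the count vectors, since constants can be homogenised through the total N. There are
as many products as count vectors, so spanning gives independence.

Lie reduction: the g with C T(g) = ρ^L(g) C form a closed subgroup. By the closed subgroup theorem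
and connectedness it is all of G once it contains every exp(tX_d) (`mem_of_generatesLieAlgebra`).
Along exp(tX_d) the relation is equivalent to its derivative C dT = dρ^L C, whose entries are the
equations of the block M_d (`classDerivation_eq`, `gepiBlock_mulVec`). -/

/-! ### One-parameter subgroups and the closed subgroup theorem -/

section OneParameter

open NormedSpace Filter Topology

variable {𝔸 : Type*} [NormedRing 𝔸] [NormedAlgebra ℝ 𝔸] [CompleteSpace 𝔸]

/-- The exponential of a real Banach algebra, as a unit. -/
noncomputable def expUnit (x : 𝔸) : 𝔸ˣ where
  val := exp x
  inv := exp (-x)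
  val_inv := by
    let _ : NormedAlgebra ℚ 𝔸 := NormedAlgebra.restrictScalars ℚ ℝ 𝔸
    rw [← exp_add_of_commute (Commute.refl x).neg_right, add_neg_cancel, exp_zero]
  inv_val := by
    let _ : NormedAlgebra ℚ 𝔸 := NormedAlgebra.restrictScalars ℚ ℝ 𝔸
    rw [← exp_add_of_commute (Commute.refl x).neg_left, neg_add_cancel, exp_zero]

@[simp] theorem val_expUnit (x : 𝔸) : (expUnit x : 𝔸) = exp x := rfl

theorem exp_continuous_real : Continuous (exp : 𝔸 → 𝔸) :=
  letI : NormedAlgebra ℚ 𝔸 := NormedAlgebra.restrictScalars ℚ ℝ 𝔸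
  exp_continuous

theorem continuous_expUnit : Continuous (expUnit : 𝔸 → 𝔸ˣ) :=
  Units.continuous_iff.2 ⟨exp_continuous_real, exp_continuous_real.comp continuous_neg⟩

@[simp] theorem expUnit_zero : expUnit (0 : 𝔸) = 1 := Units.ext (by simp)

theorem expUnit_neg (x : 𝔸) : expUnit (-x) = (expUnit x)⁻¹ := Units.ext rfl

theorem expUnit_add_of_commute {x y : 𝔸} (h : Commute x y) :
    expUnit (x + y) = expUnit x * expUnit y :=
  letI : NormedAlgebra ℚ 𝔸 := NormedAlgebra.restrictScalars ℚ ℝ 𝔸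
  Units.ext (exp_add_of_commute h)

theorem expUnit_add_smul (s t : ℝ) (x : 𝔸) :
    expUnit ((s + t) • x) = expUnit (s • x) * expUnit (t • x) := by
  rw [add_smul, expUnit_add_of_commute]
  exact ((Commute.refl x).smul_left s).smul_right t

theorem expUnit_nsmul (k : ℕ) (x : 𝔸) : expUnit (k • x) = expUnit x ^ k :=
  letI : NormedAlgebra ℚ 𝔸 := NormedAlgebra.restrictScalars ℚ ℝ 𝔸
  Units.ext (by simpa using exp_nsmul k x)

theorem expUnit_zsmul (k : ℤ) (x : 𝔸) : expUnit (k • x) = expUnit x ^ k := by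
  obtain ⟨j, rfl | rfl⟩ := k.eq_nat_or_neg
  · rw [natCast_zsmul, expUnit_nsmul, zpow_natCast]
  · rw [neg_smul, expUnit_neg, natCast_zsmul, expUnit_nsmul, zpow_neg, zpow_natCast]

theorem expUnit_conj (u : 𝔸ˣ) (x : 𝔸) : expUnit (u * x * ↑u⁻¹ : 𝔸) = u * expUnit x * u⁻¹ :=
  letI : NormedAlgebra ℚ 𝔸 := NormedAlgebra.restrictScalars ℚ ℝ 𝔸
  Units.ext (exp_units_conj u x)

/-- The generators of the one-parameter subgroups of `H`. -/
def generatorSet (H : Subgroup 𝔸ˣ) : Set 𝔸 := {x | ∀ t : ℝ, expUnit (t • x) ∈ H}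

theorem smul_mem_generatorSet {H : Subgroup 𝔸ˣ} {x : 𝔸} (hx : x ∈ generatorSet H) (c : ℝ) :
    c • x ∈ generatorSet H := fun t => by
  rw [smul_smul]; exact hx _

/-- Integer powers of exp(y_k) stay in H, and rounding t c_k down to an integer costs at most ‖y_k‖,
which tends to 0. Hence exp(tz) is a limit of elements of the closed subgroup H. -/
theorem mem_generatorSet_of_tendsto {H : Subgroup 𝔸ˣ} (hH : IsClosed (H : Set 𝔸ˣ))
    {y : ℕ → 𝔸} {c : ℕ → ℝ} {z : 𝔸} (hy : Tendsto y atTop (𝓝 0))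
    (hcy : Tendsto (fun k => c k • y k) atTop (𝓝 z)) (hyH : ∀ᶠ k in atTop, expUnit (y k) ∈ H) :
    z ∈ generatorSet H := by
  intro t
  have h1 : Tendsto (fun k => Int.fract (t * c k) • y k) atTop (𝓝 0) := by
    refine squeeze_zero_norm (fun k => ?_) (tendsto_zero_iff_norm_tendsto_zero.1 hy)
    rw [norm_smul, Real.norm_of_nonneg (Int.fract_nonneg _)]
    exact mul_le_of_le_one_left (norm_nonneg _) (Int.fract_lt_one _).le
  have h2 : Tendsto (fun k => ⌊t * c k⌋ • y k) atTop (𝓝 (t • z)) := by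
    have h3 := (hcy.const_smul t).sub h1
    rw [sub_zero] at h3
    refine h3.congr fun k => ?_
    rw [smul_smul, ← sub_smul, Int.self_sub_fract, Int.cast_smul_eq_zsmul]
  refine hH.mem_of_tendsto ((continuous_expUnit.tendsto _).comp h2) ?_
  filter_upwards [hyH] with k hk
  simp only [Function.comp, expUnit_zsmul]
  exact H.zpow_mem hk _

theorem hasStrictFDerivAt_exp_zero_equiv :
    HasStrictFDerivAt (exp : 𝔸 → 𝔸) ((ContinuousLinearEquiv.refl ℝ 𝔸 : 𝔸 ≃L[ℝ] 𝔸) : 𝔸 →L[ℝ] 𝔸) 0 :=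
  hasStrictFDerivAt_exp_zero (𝕂 := ℝ)

theorem hasDerivAt_exp_smul_zero (x : 𝔸) : HasDerivAt (fun t : ℝ => exp (t • x)) x 0 := by
  simpa using hasDerivAt_exp_smul_const x (0 : ℝ)

/-- The velocity at `1` of a differentiable curve in a closed subgroup generates a one-parameter
subgroup. -/
theorem mem_generatorSet_of_hasDerivAt {H : Subgroup 𝔸ˣ} (hH : IsClosed (H : Set 𝔸ˣ))
    {γ : ℝ → 𝔸ˣ} {z : 𝔸} (h0 : γ 0 = 1) (hγ : HasDerivAt (fun t => (γ t : 𝔸)) z 0)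
    (hmem : ∀ t, γ t ∈ H) : z ∈ generatorSet H := by
  have he := hasStrictFDerivAt_exp_zero_equiv (𝔸 := 𝔸)
  set log := he.localInverse exp _ 0 with hlog
  have h1 : HasFDerivAt log ((ContinuousLinearEquiv.refl ℝ 𝔸 : 𝔸 ≃L[ℝ] 𝔸) : 𝔸 →L[ℝ] 𝔸)
      (γ 0 : 𝔸) := by
    have := he.to_localInverse.hasFDerivAt
    simpa [h0, exp_zero] using this
  have h2 : HasDerivAt (fun t => log (γ t)) z 0 := by
    simpa [Function.comp_def] using h1.comp_hasDerivAt (0 : ℝ) hγ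
  have h3 : log (γ 0) = 0 := by
    have := he.localInverse_apply_image
    simpa [h0, exp_zero] using this
  have hs : Tendsto (fun k : ℕ => 1 / ((k : ℝ) + 1)) atTop (𝓝 0) :=
    tendsto_one_div_add_atTop_nhds_zero_nat
  have hs' : Tendsto (fun k : ℕ => 1 / ((k : ℝ) + 1)) atTop (𝓝[≠] 0) :=
    tendsto_nhdsWithin_iff.2 ⟨hs, Eventually.of_forall fun k => by
      simp only [Set.mem_compl_iff, Set.mem_singleton_iff]; positivity⟩
  -- With c_k = k + 1, the vectors c_k y_k are difference quotients of log ∘ γ at 0, so they tend to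
  -- z.
  refine mem_generatorSet_of_tendsto hH (y := fun k : ℕ => log (γ (1 / ((k : ℝ) + 1))))
    (c := fun k => (1 / ((k : ℝ) + 1))⁻¹) ?_ ?_ ?_
  · have := h2.continuousAt.tendsto.comp hs
    rwa [h3] at this
  · have := h2.tendsto_slope_zero.comp hs'
    simpa [Function.comp_def, h3] using this
  · have h4 : ∀ᶠ a in 𝓝 (γ 0 : 𝔸), exp (log a) = a := by
      have := he.eventually_right_inverse
      simpa [h0, exp_zero] using this
    filter_upwards [hs.eventually (hγ.continuousAt.eventually h4)] with k hk
    rw [show expUnit (log (γ (1 / ((k : ℝ) + 1)))) = γ (1 / ((k : ℝ) + 1)) from Units.ext hk]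
    exact hmem _

theorem add_mem_generatorSet {H : Subgroup 𝔸ˣ} (hH : IsClosed (H : Set 𝔸ˣ)) {x y : 𝔸}
    (hx : x ∈ generatorSet H) (hy : y ∈ generatorSet H) : x + y ∈ generatorSet H := by
  refine mem_generatorSet_of_hasDerivAt hH (γ := fun t => expUnit (t • x) * expUnit (t • y))
    (by simp) ?_ fun t => H.mul_mem (hx t) (hy t)
  simpa using (hasDerivAt_exp_smul_zero x).fun_mul (hasDerivAt_exp_smul_zero y)

/-- The Lie algebra of a closed subgroup, as a real subspace. -/
def generatorSubmodule (H : Subgroup 𝔸ˣ) (hH : IsClosed (H : Set 𝔸ˣ)) : Submodule ℝ 𝔸 where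
  carrier := generatorSet H
  zero_mem' := fun t => by simp [H.one_mem]
  add_mem' := add_mem_generatorSet hH
  smul_mem' := fun c _ hx => smul_mem_generatorSet hx c

/-- The commutator is the velocity at 0 of the curve t ↦ exp(tx) y exp(-tx). The curve stays in the
subspace, which is closed in finite dimension and so contains limits of difference quotients. -/
theorem commutator_mem_generatorSubmodule [FiniteDimensional ℝ 𝔸] {H : Subgroup 𝔸ˣ}
    (hH : IsClosed (H : Set 𝔸ˣ)) {x y : 𝔸} (hx : x ∈ generatorSubmodule H hH)
    (hy : y ∈ generatorSubmodule H hH) : x * y - y * x ∈ generatorSubmodule H hH := by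
  have hconj : ∀ t : ℝ, exp (t • x) * y * exp (-(t • x)) ∈ generatorSubmodule H hH := by
    intro t s
    have := H.mul_mem (H.mul_mem (hx t) (hy s)) (H.inv_mem (hx t))
    rw [← expUnit_conj] at this
    convert this using 2
    simp [← expUnit_neg]
  have hd : HasDerivAt (fun t : ℝ => exp (t • x) * y * exp (-(t • x))) (x * y - y * x) 0 := by
    have h := ((hasDerivAt_exp_smul_zero x).mul_const y).fun_mul (hasDerivAt_exp_smul_zero (-x))
    simpa [sub_eq_add_neg] using h
  have hcl : IsClosed (generatorSubmodule H hH : Set 𝔸) :=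
    Submodule.closed_of_finiteDimensional _
  refine hcl.mem_of_tendsto hd.tendsto_slope_zero (Eventually.of_forall fun t => ?_)
  refine Submodule.smul_mem _ _ (Submodule.sub_mem _ (hconj _) (hconj _))

/-- The exponential map of the Lie algebra of a closed subgroup `G` covers a neighbourhood of `1`
in `G`. -/
theorem eventually_mem_image_expUnit [FiniteDimensional ℝ 𝔸] {G : Subgroup 𝔸ˣ}
    (hG : IsClosed (G : Set 𝔸ˣ)) :
    ∀ᶠ u in 𝓝 (1 : 𝔸ˣ), u ∈ G → ∃ x ∈ generatorSet G, expUnit x = u := by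
  obtain ⟨W, hW⟩ := Submodule.exists_isCompl (generatorSubmodule G hG)
  -- Otherwise nonzero w_k → 0 in W have exponentials in G. Their directions accumulate at a unit
  -- vector of W, which generates a one-parameter subgroup of G, contradicting that W is a
  -- complement.
  have hWG : ∀ᶠ w : W in 𝓝 0, expUnit (w : 𝔸) ∈ G → w = 0 := by
    by_contra hne
    rw [Filter.not_eventually] at hne
    obtain ⟨w, hw, hwG⟩ := Filter.exists_seq_forall_of_frequently hne
    simp only [Classical.not_imp] at hwG
    have hsph : ∀ k, ‖w k‖⁻¹ • w k ∈ Metric.sphere (0 : W) 1 := fun k => by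
      rw [mem_sphere_zero_iff_norm, norm_smul, norm_inv, norm_norm,
        inv_mul_cancel₀ (norm_ne_zero_iff.2 (hwG k).2)]
    obtain ⟨v, hv, ψ, hψ, hlim⟩ := (isCompact_sphere (0 : W) 1).tendsto_subseq hsph
    have hvG : (v : 𝔸) ∈ generatorSubmodule G hG := by
      refine mem_generatorSet_of_tendsto hG (y := fun k => (w (ψ k) : 𝔸))
        (c := fun k => ‖w (ψ k)‖⁻¹) ?_ ?_ (Eventually.of_forall fun k => (hwG _).1)
      · exact (continuous_subtype_val.tendsto (0 : W)).comp (hw.comp hψ.tendsto_atTop)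
      · exact (continuous_subtype_val.tendsto v).comp hlim
    have hv0 : v = 0 :=
      Submodule.coe_eq_zero.1 (Submodule.disjoint_def.1 hW.disjoint _ hvG v.2)
    rw [mem_sphere_zero_iff_norm, hv0, norm_zero] at hv
    exact zero_ne_one hv
  let e : (generatorSubmodule G hG × W) ≃L[ℝ] 𝔸 :=
    (Submodule.prodEquivOfIsCompl _ _ hW).toContinuousLinearEquiv
  -- The map (x, w) ↦ exp(x) exp(w) is a local diffeomorphism at 0. An element of G near 1 thus has
  -- the form exp(x) exp(w) with exp(w) in G, and then w = 0.
  have hΦ : HasStrictFDerivAt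
      (fun p : generatorSubmodule G hG × W => exp (p.1 : 𝔸) * exp (p.2 : 𝔸))
      (e : (generatorSubmodule G hG × W) →L[ℝ] 𝔸) 0 := by
    have h1 := HasStrictFDerivAt.comp (0 : generatorSubmodule G hG × W)
      (g := (exp : 𝔸 → 𝔸)) (f := fun p => (p.1 : 𝔸))
      (hasStrictFDerivAt_exp_zero (𝕂 := ℝ))
      ((generatorSubmodule G hG).subtypeL.comp (ContinuousLinearMap.fst ℝ _ W)).hasStrictFDerivAt
    have h2 := HasStrictFDerivAt.comp (0 : generatorSubmodule G hG × W)
      (g := (exp : 𝔸 → 𝔸)) (f := fun p => (p.2 : 𝔸))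
      (hasStrictFDerivAt_exp_zero (𝕂 := ℝ))
      (W.subtypeL.comp (ContinuousLinearMap.snd ℝ (generatorSubmodule G hG) W)).hasStrictFDerivAt
    refine (h1.mul' h2).congr_fderiv ?_
    ext p <;> simp [e]
  have hmap := hΦ.map_nhds_eq_of_equiv
  have hev : ∀ᶠ p in 𝓝 (0 : generatorSubmodule G hG × W), expUnit (p.2 : 𝔸) ∈ G → p.2 = 0 :=
    (continuous_snd.tendsto (0 : generatorSubmodule G hG × W)).eventually hWG
  have himg := Filter.image_mem_map (m := fun p : generatorSubmodule G hG × W =>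
    exp (p.1 : 𝔸) * exp (p.2 : 𝔸)) hev
  rw [hmap] at himg
  simp only [Prod.fst_zero, Prod.snd_zero, ZeroMemClass.coe_zero, exp_zero, mul_one] at himg
  have hval : Tendsto (fun u : 𝔸ˣ => (u : 𝔸)) (𝓝 1) (𝓝 1) := Units.continuous_val.tendsto 1
  filter_upwards [hval.eventually himg] with u hu huG
  obtain ⟨p, hp, hpu⟩ := hu
  have hpu' : expUnit (p.1 : 𝔸) * expUnit (p.2 : 𝔸) = u := Units.ext hpu
  have h1G : expUnit (p.1 : 𝔸) ∈ G := by simpa using p.1.2 1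
  have hp2 : p.2 = 0 := hp ((G.mul_mem_cancel_left h1G).1 (hpu' ▸ huG))
  exact ⟨p.1, p.1.2, by simpa [hp2] using hpu'⟩

/-- A continuous one-parameter subgroup is differentiable. -/
theorem differentiableAt_zero_of_map_add {U : ℝ → 𝔸} (hU : Continuous U) (h0 : U 0 = 1)
    (hadd : ∀ s t, U (s + t) = U s * U t) : DifferentiableAt ℝ U 0 := by
  set J : ℝ → 𝔸 := fun t => ∫ s in (0 : ℝ)..t, U s with hJ
  have hJd : ∀ t, HasDerivAt J (U t) t := fun t => hU.integral_hasStrictDerivAt 0 t |>.hasDerivAt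
  -- J(ε)/ε tends to U(0) = 1, and the units are open.
  obtain ⟨ε, hε⟩ : ∃ ε, IsUnit (J ε) := by
    have h1 := (hJd 0).tendsto_slope_zero
    rw [h0] at h1
    have h2 : ∀ᶠ a in 𝓝 (1 : 𝔸), IsUnit a := Units.isOpen.mem_nhds isUnit_one
    obtain ⟨ε, hε, hne⟩ := ((h1.eventually h2).and self_mem_nhdsWithin).exists
    refine ⟨ε, ?_⟩
    have hJ0 : J 0 = 0 := by simp [hJ]
    rw [zero_add, hJ0, sub_zero] at hε
    have h3 := (IsUnit.mk0 ε hne).map (algebraMap ℝ 𝔸) |>.mul hε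
    rwa [← Algebra.smul_def, smul_smul, mul_inv_cancel₀ hne, one_smul] at h3
  obtain ⟨j, hj⟩ := hε
  -- U(t) J(ε) is the integral of U from t to t + ε; solving for U(t) exhibits it as a
  -- differentiable function.
  have key : ∀ t, U t = (J (t + ε) - J t) * (↑j⁻¹ : 𝔸) := by
    intro t
    rw [Units.eq_mul_inv_iff_mul_eq, hj, hJ]
    simp only
    rw [intervalIntegral.integral_interval_sub_left (hU.intervalIntegrable _ _)
      (hU.intervalIntegrable _ _)]
    have hmul := (ContinuousLinearMap.mul ℝ 𝔸 (U t)).intervalIntegral_comp_comm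
      (hU.intervalIntegrable (μ := MeasureTheory.volume) 0 ε)
    simp only [ContinuousLinearMap.mul_apply', ← hadd] at hmul
    rw [← hmul]
    simp
  rw [funext key]
  have h4 : DifferentiableAt ℝ (fun t => J (t + ε)) 0 :=
    ((hJd (0 + ε)).comp_add_const 0 ε).differentiableAt
  exact (h4.sub (hJd 0).differentiableAt).mul_const _

end OneParameter

/-! ### Generation of connected linear groups; derivatives of representations -/

section LinearGroup

open Filter Topology
open scoped Matrix.Norms.Operator

variable {n : ℕ}

theorem glExp_eq_expUnit (X : Matrix (Fin n) (Fin n) ℂ) : glExp X = expUnit X := Units.ext rfl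

theorem linLieAlgebra_eq_generatorSet (G : Subgroup (GL (Fin n) ℂ)) :
    linLieAlgebra G = generatorSet G := by
  simp only [linLieAlgebra, generatorSet, glExp_eq_expUnit]

/-- A closed subgroup of a connected closed linear group which contains the one-parameter subgroups
of generators of the Lie algebra is the whole group. -/
theorem mem_of_generatesLieAlgebra {G : Subgroup (GL (Fin n) ℂ)}
    (hG : IsClosed (G : Set (GL (Fin n) ℂ))) (hconn : IsConnected (G : Set (GL (Fin n) ℂ)))
    {ι : Type*} {X : ι → linLieAlgebra G} (hX : GeneratesLieAlgebra X)
    {H : Subgroup G} (hH : IsClosed (H : Set G))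
    (hXH : ∀ d (t : ℝ), (⟨glExp (t • (X d).1), (X d).2 t⟩ : G) ∈ H) (g : G) : g ∈ H := by
  have hH' : IsClosed (H.map G.subtype : Set (GL (Fin n) ℂ)) := by
    rw [Subgroup.coe_map]
    exact hG.isClosedEmbedding_subtypeVal.isClosedMap _ hH
  -- The generators of one-parameter subgroups of H form a subspace closed under commutators and
  -- containing every X_d.
  have hsub : ∀ x ∈ generatorSet G, x ∈ generatorSet (H.map G.subtype) := by
    intro x hx
    refine hX (generatorSubmodule _ hH') (fun d t => ?_)
      (fun a ha b hb => commutator_mem_generatorSubmodule hH' ha hb) x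
      (by rwa [linLieAlgebra_eq_generatorSet])
    rw [← glExp_eq_expUnit]
    exact ⟨_, hXH d t, rfl⟩
  -- Every element of G near 1 is an exponential of a Lie algebra element, so H is open; being
  -- closed too, it is all of the connected group.
  have hnhds : (H : Set G) ∈ 𝓝 (1 : G) := by
    have h1 : Tendsto (fun g : G => (g : GL (Fin n) ℂ)) (𝓝 1) (𝓝 1) :=
      continuous_subtype_val.tendsto (1 : G)
    filter_upwards [h1.eventually (eventually_mem_image_expUnit hG)] with g hg
    obtain ⟨x, hx, hxg⟩ := hg g.2
    have h2 := hsub x hx 1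
    rw [one_smul, hxg] at h2
    obtain ⟨g', hg', heq⟩ := h2
    rwa [← Subtype.ext heq]
  have : ConnectedSpace G := isConnected_iff_connectedSpace.1 hconn
  have hclopen : IsClopen (H : Set G) := ⟨hH, H.isOpen_of_mem_nhds hnhds⟩
  exact (Set.eq_univ_iff_forall.1 (hclopen.eq_univ ⟨1, H.one_mem⟩)) g

/-- The one-parameter subgroup of `G` generated by an element of the Lie algebra. -/
noncomputable def lieExp {G : Subgroup (GL (Fin n) ℂ)} (X : linLieAlgebra G) (t : ℝ) : G :=
  ⟨glExp (t • X.1), X.2 t⟩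

theorem lieExp_add {G : Subgroup (GL (Fin n) ℂ)} (X : linLieAlgebra G) (s t : ℝ) :
    lieExp X (s + t) = lieExp X s * lieExp X t :=
  Subtype.ext (by
    simp only [lieExp, glExp_eq_expUnit, Subgroup.coe_mul]
    exact expUnit_add_smul s t X.1)

@[simp] theorem lieExp_zero {G : Subgroup (GL (Fin n) ℂ)} (X : linLieAlgebra G) :
    lieExp X 0 = 1 :=
  Subtype.ext (by simp [lieExp, glExp_eq_expUnit])

theorem continuous_lieExp {G : Subgroup (GL (Fin n) ℂ)} (X : linLieAlgebra G) :
    Continuous (lieExp X) := by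
  refine Continuous.subtype_mk ?_ _
  simp only [glExp_eq_expUnit]
  exact continuous_expUnit.comp (by fun_prop)

/-- `deriv` is 0 by default where no derivative exists. Here continuity of ρ already forces
differentiability, so `repDeriv` is a genuine derivative. -/
theorem hasDerivAt_repDeriv {𝕜 : Type*} [RCLike 𝕜] {G : Subgroup (GL (Fin n) ℂ)}
    {κ : Type*} [Fintype κ] [DecidableEq κ] {ρ : G →* Matrix κ κ 𝕜} (hρ : Continuous ρ)
    (X : linLieAlgebra G) (a b : κ) :
    HasDerivAt (fun t : ℝ => ρ (lieExp X t) a b) (repDeriv ρ X a b) 0 := by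
  have h1 : DifferentiableAt ℝ (fun t : ℝ => ρ (lieExp X t)) 0 :=
    differentiableAt_zero_of_map_add (hρ.comp (continuous_lieExp X)) (by simp)
      fun s t => by rw [lieExp_add, map_mul]
  have h2 : DifferentiableAt ℝ (fun t : ℝ => ρ (lieExp X t) a b) 0 := by
    have h3 : DifferentiableAt ℝ (fun A : Matrix κ κ 𝕜 => A a b) (ρ (lieExp X 0)) :=
      (LinearMap.toContinuousLinearMap (Matrix.entryLinearMap ℝ 𝕜 a b)).differentiableAt
    exact DifferentiableAt.comp (0 : ℝ) h3 h1
  exact h2.hasDerivAt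

end LinearGroup

/-! ### Intertwiners of one-parameter matrix groups -/

section Intertwining

variable {𝕜 : Type*} [RCLike 𝕜] {α β : Type*}

theorem hasDerivAt_matrix_mul_apply {γ : Type*} [Fintype β] {U : ℝ → Matrix α β 𝕜} {V : ℝ → Matrix β γ 𝕜}
    {A : Matrix α β 𝕜} {B : Matrix β γ 𝕜} {t : ℝ}
    (hU : ∀ i j, HasDerivAt (fun s => U s i j) (A i j) t)
    (hV : ∀ i j, HasDerivAt (fun s => V s i j) (B i j) t) (i : α) (j : γ) :
    HasDerivAt (fun s => (U s * V s) i j) ((A * V t + U t * B) i j) t := by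
  simp only [Matrix.mul_apply, Matrix.add_apply, ← Finset.sum_add_distrib]
  exact HasDerivAt.fun_sum fun k _ => (hU i k).fun_mul (hV k j)

variable [Fintype α] [DecidableEq α]

theorem hasDerivAt_of_map_add {U : ℝ → Matrix α α 𝕜} {A : Matrix α α 𝕜}
    (hadd : ∀ s t, U (s + t) = U s * U t)
    (hU : ∀ i j, HasDerivAt (fun s => U s i j) (A i j) 0) (t : ℝ) (i j : α) :
    HasDerivAt (fun s => U s i j) ((U t * A) i j) t := by
  have h1 := hasDerivAt_matrix_mul_apply (U := fun _ => U t) (A := 0)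
    (fun i j => hasDerivAt_const (0 : ℝ) (U t i j)) hU i j
  rw [zero_mul, zero_add] at h1
  simp only [← hadd] at h1
  have h2 : HasDerivAt (fun s : ℝ => s - t) 1 t := (hasDerivAt_id t).sub_const t
  have h3 := HasDerivAt.scomp_of_eq t h1 h2 (by simp)
  simpa [Function.comp_def] using h3

variable [Fintype β] [DecidableEq β]

/-- A matrix intertwines two one-parameter groups iff it intertwines their generators. -/
theorem intertwines_iff_of_map_add {U : ℝ → Matrix α α 𝕜} {V : ℝ → Matrix β β 𝕜}
    {A : Matrix α α 𝕜} {B : Matrix β β 𝕜} (C : Matrix β α 𝕜)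
    (hU0 : U 0 = 1) (hUadd : ∀ s t, U (s + t) = U s * U t)
    (hU : ∀ i j, HasDerivAt (fun s => U s i j) (A i j) 0)
    (hV0 : V 0 = 1) (hVadd : ∀ s t, V (s + t) = V s * V t)
    (hV : ∀ i j, HasDerivAt (fun s => V s i j) (B i j) 0) :
    (∀ t, C * U t = V t * C) ↔ C * A = B * C := by
  have hconst : ∀ t i j, HasDerivAt (fun _ : ℝ => C i j) ((0 : Matrix β α 𝕜) i j) t :=
    fun t i j => hasDerivAt_const _ _
  constructor
  · intro h
    ext i j
    have h1 := hasDerivAt_matrix_mul_apply (hconst 0) hU i j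
    have h2 := hasDerivAt_matrix_mul_apply hV (hconst 0) i j
    simp only [h] at h1
    simpa using h1.unique h2
  · intro h t
    have hneg : ∀ t i j, HasDerivAt (fun s => V (-s) i j) ((-(V (-t) * B)) i j) t := by
      intro t i j
      have h3 := HasDerivAt.scomp_of_eq t (hasDerivAt_of_map_add hVadd hV (-t) i j)
        (hasDerivAt_neg t) rfl
      simpa [Function.comp_def] using h3
    have hUt : ∀ t, U t * A = A * U t := by
      intro t
      ext i j
      have h4 := hasDerivAt_matrix_mul_apply (V := fun _ => U t) (B := 0) hU
        (fun i j => hasDerivAt_const (0 : ℝ) (U t i j)) i j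
      have h5 := hasDerivAt_matrix_mul_apply (U := fun _ => U t) (A := 0)
        (fun i j => hasDerivAt_const (0 : ℝ) (U t i j)) hU i j
      simp only [← hUadd, add_comm _ t] at h4 h5
      simpa using h5.unique h4
    -- As U(t) commutes with A, the derivative of V(-t) C U(t) is V(-t) (CA - BC) U(t) = 0.
    have hder : ∀ t i j, HasDerivAt (fun s => (V (-s) * (C * U s)) i j) 0 t := by
      intro t i j
      have h6 := hasDerivAt_matrix_mul_apply (hneg t)
        (hasDerivAt_matrix_mul_apply (hconst t) (hasDerivAt_of_map_add hUadd hU t)) i j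
      have h8 : -(V (-t) * B) * (C * U t) + V (-t) * ((0 : Matrix β α 𝕜) * U t + C * (U t * A))
          = 0 := by
        rw [Matrix.zero_mul, zero_add, hUt, ← Matrix.mul_assoc C, h]
        simp [Matrix.mul_assoc]
      rwa [h8] at h6
    have hone : V (-t) * (C * U t) = C := by
      ext i j
      have h7 := is_const_of_deriv_eq_zero (fun t => (hder t i j).differentiableAt)
        (fun t => (hder t i j).deriv) t 0
      simpa [hU0, hV0] using h7
    calc C * U t = V (t + -t) * (C * U t) := by rw [add_neg_cancel, hV0, Matrix.one_mul]
      _ = V t * C := by rw [hVadd, Matrix.mul_assoc, hone]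

end Intertwining

/-! ### Linear independence of products of one-particle sums -/

section Independence

variable {ι Ω 𝔽 : Type*} [Fintype ι] [Field 𝔽]

/-- Linearly independent functions `ψ a` admit points `x c` and linear combinations that are dual
to the evaluations at these points. -/
theorem exists_points_dual_of_linearIndependent [DecidableEq ι] {ψ : ι → Ω → 𝔽}
    (hψ : LinearIndependent 𝔽 ψ) :
    ∃ (x : ι → Ω) (B : Matrix ι ι 𝔽),
      ∀ b c, ∑ a, B b a * ψ a (x c) = if b = c then 1 else 0 := by
  classical
  set s : Set (ι → 𝔽) := Set.range fun (r : Ω) (a : ι) => ψ a r with hs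
  -- A nonzero functional killing all evaluation vectors (ψ_a(r))_a would be a linear relation among
  -- the ψ_a.
  have hspan : Submodule.span 𝔽 s = ⊤ := by
    by_contra hne
    obtain ⟨f, hf0, hf⟩ := Submodule.exists_le_ker_of_lt_top _ (lt_top_iff_ne_top.2 hne)
    refine hf0 (LinearMap.pi_ext' fun a => LinearMap.ext_ring ?_)
    have hzero : ∑ a, f (Pi.single a 1) • ψ a = 0 := by
      funext r
      have h1 : f (fun a => ψ a r) = 0 := hf (Submodule.subset_span ⟨r, rfl⟩)
      have h2 : ∀ a : ι, (fun j => if a = j then (1 : 𝔽) else 0) = Pi.single a 1 := fun a => by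
        funext j
        simp [Pi.single_apply, eq_comm]
      rw [LinearMap.pi_apply_eq_sum_univ] at h1
      simp only [h2] at h1
      simpa [mul_comm, Finset.sum_apply] using h1
    simpa using Fintype.linearIndependent_iff.1 hψ _ hzero a
  -- A basis is extracted from the evaluation vectors; B is the change of basis to it.
  obtain ⟨b, hbs, hbspan, hb⟩ := exists_linearIndependent 𝔽 s
  rw [hspan] at hbspan
  let β : Module.Basis b 𝔽 (ι → 𝔽) := Module.Basis.mk hb (by simp [hbspan])
  let e : ι ≃ b := (Pi.basisFun 𝔽 ι).indexEquiv β
  choose x hx using fun c : ι => hbs (e c).2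
  refine ⟨x, ((β.reindex e.symm).toMatrix (Pi.basisFun 𝔽 ι)), fun i c => ?_⟩
  have h2 := congrFun (congrFun ((β.reindex e.symm).toMatrix_mul_toMatrix_flip
    (Pi.basisFun 𝔽 ι)) i) c
  rw [Matrix.mul_apply, Matrix.one_apply] at h2
  rw [← h2]
  refine Finset.sum_congr rfl fun a _ => ?_
  congr 1
  have h3 : (β.reindex e.symm) c = fun a => ψ a (x c) := by
    simp [β, ← hx]
  rw [Module.Basis.toMatrix_apply, h3]
  simp

variable {N : ℕ}

/-- The number of occurrences of `b` in the tuple `p`. -/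
noncomputable def occurrences {β : Type*} (p : Fin N → β) (b : β) : ℕ := Nat.card {i // p i = b}

theorem occurrences_eq_card {β : Type*} [DecidableEq β] (p : Fin N → β) (b : β) :
    occurrences p b = (Finset.univ.filter fun i => p i = b).card := by
  rw [occurrences, Nat.card_eq_fintype_card, Fintype.card_subtype]

theorem exists_perm_of_occurrences_eq {β : Type*} {p q : Fin N → β}
    (h : occurrences p = occurrences q) : ∃ σ : Equiv.Perm (Fin N), ∀ i, p i = q (σ i) := by
  have h1 : ∀ b, Nonempty ({i // p i = b} ≃ {i // q i = b}) := fun b =>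
    Finite.card_eq.1 (congrFun h b)
  refine ⟨Equiv.ofFiberEquiv fun b => (h1 b).some, fun i => ?_⟩
  exact (Equiv.ofFiberEquiv_map _ i).symm

theorem sum_occurrences [DecidableEq ι] (p : Fin N → ι) : ∑ b, occurrences p b = N := by
  simp only [occurrences_eq_card]
  rw [← Finset.card_eq_sum_card_fiberwise (f := p) (t := Finset.univ) (by simp)]
  simp

/-- The products that separate the count vectors: they vanish at a tuple unless it has the same
count vector as `q`. -/
theorem prod_occurrences_sub_rank [CharZero 𝔽] [DecidableEq ι] (q p : Fin N → ι) :
    ∏ i, ((occurrences p (q i) : 𝔽) - ((Finset.univ.filter fun i' => i' < i ∧ q i' = q i).card : 𝔽))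
      ≠ 0 ↔ occurrences p = occurrences q := by
  constructor
  · intro h
    by_contra hne
    -- Both count vectors have total N, so if they differ, some entry is smaller for p.
    obtain ⟨b, hb⟩ : ∃ b, occurrences p b < occurrences q b := by
      by_contra! hle
      refine hne (funext fun b => ((Finset.sum_eq_sum_iff_of_le fun b _ => hle b).1 ?_ b
        (Finset.mem_univ b)).symm)
      rw [sum_occurrences, sum_occurrences]
    let s := Finset.univ.filter fun i => q i = b
    -- The positions where q takes the value b have ranks 0, 1, …, `occurrences q b` - 1. One of
    -- them equals the smaller number `occurrences p b` and kills the product.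
    have hrank : ∃ i ∈ s, (Finset.univ.filter fun i' => i' < i ∧ q i' = b).card
        = occurrences p b := by
      have hmono : ∀ i ∈ s, ∀ j ∈ s, i < j →
          (Finset.univ.filter fun i' => i' < i ∧ q i' = b).card
            < (Finset.univ.filter fun i' => i' < j ∧ q i' = b).card := by
        intro i hi j _ hij
        refine Finset.card_lt_card ((Finset.ssubset_iff_of_subset ?_).2 ⟨i, ?_, ?_⟩)
        · intro i' hi'
          simp only [Finset.mem_filter, Finset.mem_univ, true_and] at hi' ⊢
          exact ⟨hi'.1.trans hij, hi'.2⟩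
        · simpa [s] using ⟨hij, (Finset.mem_filter.1 hi).2⟩
        · simp
      have hsurj := Finset.surj_on_of_inj_on_of_card_le (s := s)
        (t := Finset.range s.card)
        (fun i _ => (Finset.univ.filter fun i' => i' < i ∧ q i' = b).card)
        (fun i hi => by
          refine Finset.mem_range.2 (Finset.card_lt_card
            ((Finset.ssubset_iff_of_subset ?_).2 ⟨i, hi, ?_⟩))
          · intro i' hi'
            simp only [s, Finset.mem_filter, Finset.mem_univ, true_and] at hi' ⊢
            exact hi'.2
          · simp)
        (fun i j hi hj hij => by
          rcases lt_trichotomy i j with h1 | h1 | h1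
          · exact absurd hij (hmono i hi j hj h1).ne
          · exact h1
          · exact absurd hij (hmono j hj i hi h1).ne')
        (by simp)
      obtain ⟨i, hi, h1⟩ := hsurj (occurrences p b)
        (Finset.mem_range.2 (by rwa [occurrences_eq_card q] at hb))
      exact ⟨i, hi, h1.symm⟩
    obtain ⟨i, hi, hri⟩ := hrank
    have hqi : q i = b := (Finset.mem_filter.1 hi).2
    refine h (Finset.prod_eq_zero (Finset.mem_univ i) ?_)
    rw [hqi, hri, sub_self]
  · intro h
    rw [h, Finset.prod_ne_zero_iff]
    intro i _
    rw [sub_ne_zero, Nat.cast_injective.ne_iff, occurrences_eq_card]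
    refine (Finset.card_lt_card ((Finset.ssubset_iff_of_subset ?_).2 ⟨i, ?_, ?_⟩)).ne'
    · intro i' hi'
      simp only [Finset.mem_filter, Finset.mem_univ, true_and] at hi' ⊢
      exact hi'.2
    · simp
    · simp

theorem prod_comp_eq_of_occurrences_eq {β : Type*} {p q : Fin N → β} (h : occurrences p = occurrences q)
    (f : β → 𝔽) : ∏ i, f (p i) = ∏ i, f (q i) := by
  obtain ⟨σ, hσ⟩ := exists_perm_of_occurrences_eq h
  simp only [hσ]
  exact Equiv.prod_comp σ fun i => f (q i)

/-- Products of `N` one-particle sums in `N` particles, taken over tuples with different count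
vectors, are linearly independent. -/
theorem linearIndependent_prod_sum [CharZero 𝔽] {ψ : ι → Ω → 𝔽} (hψ : LinearIndependent 𝔽 ψ)
    {J : Type*} (p : J → Fin N → ι) (hp : Function.Injective fun j => occurrences (p j)) :
    LinearIndependent 𝔽 fun (j : J) (R : Fin N → Ω) => ∏ i, ∑ k, ψ (p j i) (R k) := by
  classical
  obtain ⟨x, B, hB⟩ := exists_points_dual_of_linearIndependent hψ
  let I : Type _ := Set.range (occurrences : (Fin N → ι) → ι → ℕ)
  let _ : Fintype I := Fintype.ofFinite I
  choose rep hrep using fun c : I => c.2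
  let E : I → I → 𝔽 := fun w c => ∏ i, ∑ k, ψ (rep w i) (x (rep c k))
  have hcount : ∀ (c : I) b, ∑ a, B b a * ∑ k, ψ a (x (rep c k)) = occurrences (rep c) b := by
    intro c b
    simp only [Finset.mul_sum]
    rw [Finset.sum_comm]
    simp only [hB]
    rw [occurrences_eq_card, Finset.sum_boole]
    simp [eq_comm]
  have hforms : ∀ u : Fin N → ι → 𝔽,
      (fun c : I => ∏ i, ∑ a, u i a * ∑ k, ψ a (x (rep c k))) ∈ Submodule.span 𝔽 (Set.range E) := by
    intro u
    have h1 : (fun c : I => ∏ i, ∑ a, u i a * ∑ k, ψ a (x (rep c k)))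
        = ∑ t : Fin N → ι, (∏ i, u i (t i)) • E ⟨occurrences t, t, rfl⟩ := by
      funext c
      rw [Finset.prod_univ_sum, Fintype.piFinset_univ, Finset.sum_apply]
      refine Finset.sum_congr rfl fun t _ => ?_
      rw [Finset.prod_mul_distrib, Pi.smul_apply, smul_eq_mul]
      congr 1
      exact prod_comp_eq_of_occurrences_eq (hrep ⟨occurrences t, t, rfl⟩).symm
        fun a => ∑ k, ψ a (x (rep c k))
    rw [h1]
    exact Submodule.sum_mem _ fun t _ => Submodule.smul_mem _ _ (Submodule.subset_span ⟨_, rfl⟩)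
  -- The separating product of the count vector d has factors λ_b - rank, which are not homogeneous.
  -- Since the entries λ_b sum to N, the constant equals (rank / N) ∑ λ_b, which makes each factor a
  -- linear form.
  have hdelta : ∀ d : I, Pi.single d (1 : 𝔽) ∈ Submodule.span 𝔽 (Set.range E) := by
    intro d
    let rk : Fin N → 𝔽 := fun i =>
      ((Finset.univ.filter fun i' => i' < i ∧ rep d i' = rep d i).card : 𝔽)
    have h2 := hforms fun i a => B (rep d i) a - rk i / N * ∑ b, B b a
    have h3 : ∀ (c : I) i, ∑ a, (B (rep d i) a - rk i / N * ∑ b, B b a)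
        * ∑ k, ψ a (x (rep c k)) = occurrences (rep c) (rep d i) - rk i := by
      intro c i
      have hN : (N : 𝔽) ≠ 0 := Nat.cast_ne_zero.2 (Nat.pos_iff_ne_zero.1 i.pos)
      have h4 : ∑ a, (∑ b, B b a) * ∑ k, ψ a (x (rep c k)) = N := by
        simp only [Finset.sum_mul]
        rw [Finset.sum_comm]
        simp only [hcount]
        rw [← Nat.cast_sum, sum_occurrences]
      simp only [sub_mul, mul_assoc, Finset.sum_sub_distrib, ← Finset.mul_sum]
      rw [hcount, h4, div_mul_cancel₀ _ hN]
    simp only [h3] at h2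
    have h5 : ∀ c : I, ∏ i, ((occurrences (rep c) (rep d i) : 𝔽) - rk i) ≠ 0 ↔ c = d := by
      intro c
      rw [prod_occurrences_sub_rank, hrep, hrep, Subtype.ext_iff]
    have h6 : Pi.single d (1 : 𝔽)
        = (∏ i, ((occurrences (rep d) (rep d i) : 𝔽) - rk i))⁻¹ •
          fun c : I => ∏ i, ((occurrences (rep c) (rep d i) : 𝔽) - rk i) := by
      funext c
      rw [Pi.smul_apply, smul_eq_mul]
      rcases eq_or_ne c d with rfl | hcd
      · rw [Pi.single_eq_same, inv_mul_cancel₀ ((h5 c).2 rfl)]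
      · rw [Pi.single_eq_of_ne hcd, not_not.1 ((h5 c).not.2 hcd), mul_zero]
    rw [h6]
    exact Submodule.smul_mem _ _ h2
  have hE : LinearIndependent 𝔽 E := by
    refine linearIndependent_of_top_le_span_of_card_eq_finrank ?_ (by simp)
    rw [← (Pi.basisFun 𝔽 I).span_eq, Submodule.span_le]
    rintro _ ⟨d, rfl⟩
    rw [Pi.basisFun_apply]
    exact hdelta d
  -- Independence of the restrictions to finitely many configurations suffices.
  let restr : ((Fin N → Ω) → 𝔽) →ₗ[𝔽] (I → 𝔽) :=
    LinearMap.funLeft 𝔽 𝔽 fun c k => x (rep c k)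
  refine LinearIndependent.of_comp restr ?_
  have hinj : Function.Injective fun j : J => (⟨occurrences (p j), p j, rfl⟩ : I) :=
    fun i j hij => hp (Subtype.ext_iff.1 hij)
  convert hE.comp _ hinj using 1
  funext j c
  exact prod_comp_eq_of_occurrences_eq (hrep ⟨occurrences (p j), p j, rfl⟩).symm
    fun a => ∑ k, ψ a (x (rep c k))

end Independence

/-! ### Classes, count vectors and replacement of one entry -/

section ClassLemmas

variable {𝓛 : Type*} {M : 𝓛 → Type*} {N : ℕ} {l : Fin N → 𝓛}

/-- The class of a multi-index. -/
def orbitMk (m : MultiIndex M l) : OrbitClass M l := Quotient.mk (orbitSetoid M l) m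

/-- A representative of a class. -/
noncomputable def orbitRep (m : OrbitClass M l) : MultiIndex M l := Quotient.out m

@[simp] theorem orbitMk_orbitRep (m : OrbitClass M l) : orbitMk (orbitRep m) = m :=
  Quotient.out_eq m

/-- The multi-index `a` with the entry at `j` replaced by `q`. -/
def replaceAt (a : MultiIndex M l) (j : Fin N) (q : M (l j)) : MultiIndex M l :=
  Function.update a j q

@[simp] theorem replaceAt_same (a : MultiIndex M l) (j : Fin N) (q : M (l j)) :
    replaceAt a j q j = q := Function.update_self ..

theorem replaceAt_of_ne (a : MultiIndex M l) {i j : Fin N} (h : i ≠ j) (q : M (l j)) :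
    replaceAt a j q i = a i := Function.update_of_ne h ..

theorem countVec_orbitMk (m : MultiIndex M l) : countVec (orbitMk m) = occurrences (pairAt m) :=
  rfl

/-- Tuples with equal counts differ by a permutation of positions. The pairs record l_i as well, so
this permutation fixes l. -/
theorem countVec_injective : Function.Injective (countVec : OrbitClass M l → (Σ v, M v) → ℕ) := by
  intro a b h
  rw [← orbitMk_orbitRep a, ← orbitMk_orbitRep b, countVec_orbitMk, countVec_orbitMk] at h
  rw [← orbitMk_orbitRep a, ← orbitMk_orbitRep b]
  obtain ⟨σ, hσ⟩ := exists_perm_of_occurrences_eq h.symm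
  exact Quotient.sound ⟨σ, fun i => (congrArg Sigma.fst (hσ i)).symm, hσ⟩

/-- Changing one entry of a multi-index moves one unit of its count vector. -/
theorem occurrences_replaceAt_add (a : MultiIndex M l) (j : Fin N) (q : M (l j)) (s : Σ v, M v) :
    (occurrences (pairAt (replaceAt a j q)) s : ℤ)
        + Set.indicator {(⟨l j, a j⟩ : Σ v, M v)} 1 s
      = occurrences (pairAt a) s + Set.indicator {(⟨l j, q⟩ : Σ v, M v)} 1 s := by
  classical
  have h : ∀ b : MultiIndex M l, (occurrences (pairAt b) s : ℤ)
      = (if pairAt b j = s then 1 else 0)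
        + ∑ i ∈ Finset.univ.erase j, if pairAt b i = s then (1 : ℤ) else 0 := by
    intro b
    rw [Finset.add_sum_erase _ (fun i => if pairAt b i = s then (1 : ℤ) else 0)
      (Finset.mem_univ j), occurrences_eq_card, Finset.sum_boole]
  rw [h, h]
  have h1 : ∑ i ∈ Finset.univ.erase j, (if pairAt (replaceAt a j q) i = s then (1 : ℤ) else 0)
      = ∑ i ∈ Finset.univ.erase j, if pairAt a i = s then (1 : ℤ) else 0 := by
    refine Finset.sum_congr rfl fun i hi => ?_
    rw [pairAt, pairAt, replaceAt_of_ne _ (Finset.ne_of_mem_erase hi)]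
  have h2 : pairAt (replaceAt a j q) j = ⟨l j, q⟩ := by simp [pairAt]
  rw [h1, h2]
  simp only [pairAt, Set.indicator_apply, Set.mem_singleton_iff, Pi.one_apply, eq_comm (b := s)]
  ring

theorem orbitMk_replaceAt_eq_iff (a : MultiIndex M l) (j : Fin N) (q : M (l j)) :
    orbitMk (replaceAt a j q) = orbitMk a ↔ q = a j := by
  constructor
  · intro h
    by_contra hne
    have h1 := occurrences_replaceAt_add a j q ⟨l j, q⟩
    rw [← countVec_orbitMk, ← countVec_orbitMk, h] at h1
    simp [hne] at h1
  · rintro rfl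
    rw [replaceAt, Function.update_eq_self]

theorem orbitMk_replaceAt_eq_iff_isInteracting {m : OrbitClass M l} (a : MultiIndex M l) (j : Fin N)
    (q : M (l j)) (hm : m ≠ orbitMk a) :
    orbitMk (replaceAt a j q) = m ↔ IsInteracting m (orbitMk a) (l j) q (a j) := by
  have hupd : ∀ s, (countVec (orbitMk (replaceAt a j q)) s : ℤ)
        + Set.indicator {(⟨l j, a j⟩ : Σ v, M v)} 1 s
      = countVec (orbitMk a) s + Set.indicator {(⟨l j, q⟩ : Σ v, M v)} 1 s :=
    occurrences_replaceAt_add a j q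
  constructor
  · rintro rfl
    have hq : q ≠ a j := fun h => hm ((orbitMk_replaceAt_eq_iff a j q).2 h)
    refine ⟨hq, ?_, fun s => by linarith [hupd s]⟩
    have h1 := hupd ⟨l j, q⟩
    simp [hq] at h1
    omega
  · rintro ⟨-, -, h⟩
    refine countVec_injective (funext fun s => ?_)
    have := h s
    have := hupd s
    omega

end ClassLemmas

/-! ### Independence and transformation of the class functions -/

section ClassFunctions

variable {𝓛 : Type*} {M : 𝓛 → Type*} {N : ℕ} {l : Fin N → 𝓛} {Ω 𝔽 : Type*} [Field 𝔽]

theorem classProdSum_orbitMk (φ : ∀ v, M v → Ω → 𝔽) (m : MultiIndex M l) :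
    classProdSum φ (orbitMk m) = prodSum φ m := rfl

theorem classProdSum_comp_perm (φ : ∀ v, M v → Ω → 𝔽) (m : OrbitClass M l)
    (σ : Equiv.Perm (Fin N)) (R : Fin N → Ω) :
    classProdSum φ m (fun i => R (σ i)) = classProdSum φ m R := by
  rw [← orbitMk_orbitRep m, classProdSum_orbitMk]
  refine Finset.prod_congr rfl fun i _ => ?_
  exact Equiv.sum_comp σ fun k => φ _ _ (R k)

/-- Only the finitely many one-particle functions with v among the values of l occur, so the finite
case applies to this subfamily S. -/
theorem linearIndependent_classProdSum [CharZero 𝔽] [∀ v, Finite (M v)] {φ : ∀ v, M v → Ω → 𝔽}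
    (hφ : LinearIndependent 𝔽 fun s : (Σ v, M v) => φ s.1 s.2) :
    LinearIndependent 𝔽 fun m : OrbitClass M l => classProdSum φ m := by
  let S := Set.range fun t : (Σ i : Fin N, M (l i)) => (⟨l t.1, t.2⟩ : Σ v, M v)
  have : Fintype S := Fintype.ofFinite S
  have hS := hφ.comp (Subtype.val : S → _) Subtype.val_injective
  let p : OrbitClass M l → Fin N → S := fun m i =>
    ⟨pairAt (orbitRep m) i, ⟨i, orbitRep m i⟩, rfl⟩
  have hp : Function.Injective fun m => occurrences (p m) := by
    intro a b h
    obtain ⟨σ, hσ⟩ := exists_perm_of_occurrences_eq h.symm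
    rw [← orbitMk_orbitRep a, ← orbitMk_orbitRep b]
    have hσ' : ∀ i, pairAt (orbitRep b) i = pairAt (orbitRep a) (σ i) := fun i =>
      Subtype.ext_iff.1 (hσ i)
    exact Quotient.sound ⟨σ, fun i => (congrArg Sigma.fst (hσ' i)).symm, hσ'⟩
  convert linearIndependent_prod_sum hS p hp using 1
  funext m
  conv_lhs => rw [← orbitMk_orbitRep m, classProdSum_orbitMk]
  rfl

variable {𝕜 : Type*} [Field 𝕜] [Algebra 𝕜 𝔽]

theorem permInvSpace_eq_span_classProdSum (φ : ∀ v, M v → Ω → 𝔽) :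
    permInvSpace 𝕜 φ l
      = Submodule.span 𝕜 (Set.range fun m : OrbitClass M l => classProdSum φ m) := by
  rw [permInvSpace]
  congr 1
  refine Set.Subset.antisymm ?_ ?_
  · rintro _ ⟨m, rfl⟩
    exact ⟨orbitMk m, rfl⟩
  · rintro _ ⟨m, rfl⟩
    exact ⟨orbitRep m, by simp only [← classProdSum_orbitMk, orbitMk_orbitRep]⟩

variable [∀ v, Fintype (M v)]

open Classical in
/-- The matrix by which matrices `A v` acting on the one-particle functions act on the functions
`classProdSum φ m`. -/
noncomputable def classAction (A : ∀ v, Matrix (M v) (M v) 𝕜) (l : Fin N → 𝓛) :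
    Matrix (OrbitClass M l) (OrbitClass M l) 𝕜 :=
  Matrix.of fun m m' => ∑ b : MultiIndex M l with orbitMk b = m', ∏ i, A (l i) (orbitRep m i) (b i)

theorem classProdSum_transform {φ φ' : ∀ v, M v → Ω → 𝔽} {A : ∀ v, Matrix (M v) (M v) 𝕜}
    {R R' : Fin N → Ω} (h : ∀ v p k, φ' v p (R' k) = ∑ p', A v p p' • φ v p' (R k))
    (m : OrbitClass M l) :
    classProdSum φ' m R' = ∑ m', classAction A l m m' • classProdSum φ m' R := by
  classical
  conv_lhs => rw [← orbitMk_orbitRep m, classProdSum_orbitMk]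
  have h1 : ∀ i, oneParticleSum φ' (pairAt (orbitRep m) i) R'
      = ∑ q : M (l i), A (l i) (orbitRep m i) q • oneParticleSum φ ⟨l i, q⟩ R := by
    intro i
    simp only [oneParticleSum, pairAt, h, Finset.smul_sum]
    exact Finset.sum_comm
  have h2 : ∀ b : MultiIndex M l,
      ∏ i, A (l i) (orbitRep m i) (b i) • oneParticleSum φ ⟨l i, b i⟩ R
        = (∏ i, A (l i) (orbitRep m i) (b i)) • prodSum φ b R := by
    intro b
    simp only [Algebra.smul_def, Finset.prod_mul_distrib, map_prod]
    rfl
  rw [prodSum, Finset.prod_congr rfl fun i _ => h1 i, Finset.prod_univ_sum,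
    Fintype.piFinset_univ, Finset.sum_congr rfl fun b _ => h2 b,
    ← Finset.sum_fiberwise (g := fun b : MultiIndex M l => orbitMk b)]
  refine Finset.sum_congr rfl fun m' _ => ?_
  rw [classAction, Matrix.of_apply, Finset.sum_smul]
  refine Finset.sum_congr (by ext; simp) fun b hb => ?_
  rw [← (Finset.mem_filter.1 hb).2, classProdSum_orbitMk]

theorem sum_smul_classProdSum_injective [CharZero 𝔽] {φ : ∀ v, M v → Ω → 𝔽}
    (hφ : LinearIndependent 𝔽 fun s : (Σ v, M v) => φ s.1 s.2) {c c' : OrbitClass M l → 𝕜}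
    (h : ∀ R, ∑ m, c m • classProdSum φ m R = ∑ m, c' m • classProdSum φ m R) : c = c' := by
  have hli : LinearIndependent 𝕜 fun m : OrbitClass M l => classProdSum φ m :=
    (linearIndependent_classProdSum hφ).restrict_scalars fun a b hab => by
      simpa [Algebra.smul_def] using hab
  refine funext fun m => ?_
  have h1 : ∑ m, (c m - c' m) • classProdSum φ m = 0 := by
    funext R
    simp [sub_smul, Finset.sum_apply, h R]
  exact sub_eq_zero.1 (Fintype.linearIndependent_iff.1 hli _ h1 m)

end ClassFunctions

/-! ### The infinitesimal action on classes and the blocks of the matrix -/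

section Derivative

variable {𝓛 : Type*} {M : 𝓛 → Type*} {N : ℕ} {𝕜 : Type*} [Field 𝕜] [∀ v, Fintype (M v)]

open Classical in
/-- The derivative of `classAction` at the identity in the direction `D`. -/
noncomputable def classDerivation (D : ∀ v, Matrix (M v) (M v) 𝕜) (l : Fin N → 𝓛) :
    Matrix (OrbitClass M l) (OrbitClass M l) 𝕜 :=
  Matrix.of fun m m' => ∑ j, ∑ q : M (l j),
    if orbitMk (replaceAt (orbitRep m) j q) = m' then D (l j) (orbitRep m j) q else 0

/-- By the product rule, all factors except the one at j are evaluated at t = 0, where they are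
entries of the identity. Only multi-indices agreeing with the representative away from j survive. -/
theorem hasDerivAt_classAction {𝕜 : Type*} [RCLike 𝕜] [∀ v, DecidableEq (M v)]
    {A : ℝ → ∀ v, Matrix (M v) (M v) 𝕜}
    {D : ∀ v, Matrix (M v) (M v) 𝕜} {l : Fin N → 𝓛} (h0 : ∀ v, A 0 v = 1)
    (hA : ∀ v p q, HasDerivAt (fun t => A t v p q) (D v p q) 0) (m m' : OrbitClass M l) :
    HasDerivAt (fun t => classAction (A t) l m m') (classDerivation D l m m') 0 := by
  classical
  have h1 : HasDerivAt (fun t => classAction (A t) l m m')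
      (∑ b : MultiIndex M l with orbitMk b = m', ∑ j,
        (∏ i ∈ Finset.univ.erase j, A 0 (l i) (orbitRep m i) (b i)) •
          D (l j) (orbitRep m j) (b j)) 0 := by
    refine HasDerivAt.fun_sum fun b _ => ?_
    exact HasDerivAt.fun_finsetProd fun i _ => hA _ _ _
  convert h1 using 1
  rw [Finset.sum_comm, classDerivation, Matrix.of_apply]
  refine Finset.sum_congr rfl fun j _ => ?_
  rw [Finset.sum_filter]
  refine Finset.sum_of_injOn (fun q => replaceAt (orbitRep m) j q) ?_ (by simp) ?_ ?_
  · intro q _ q' _ h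
    simpa using congrFun h j
  · intro b _ hb
    obtain ⟨i, hij, hi⟩ : ∃ i, i ≠ j ∧ orbitRep m i ≠ b i := by
      by_contra! hall
      refine hb ⟨b j, by simp, funext fun i => ?_⟩
      rcases eq_or_ne i j with rfl | hij
      · simp
      · simp [replaceAt_of_ne _ hij, hall i hij]
    rw [Finset.prod_eq_zero (Finset.mem_erase.2 ⟨hij, Finset.mem_univ i⟩)
      (by rw [h0, Matrix.one_apply_ne hi]), zero_smul, ite_self]
  · intro q _
    rw [Finset.prod_eq_one fun i hi => by
      rw [h0, replaceAt_of_ne _ (Finset.ne_of_mem_erase hi), Matrix.one_apply_eq], one_smul,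
      replaceAt_same]

theorem classDerivation_eq (D : ∀ v, Matrix (M v) (M v) 𝕜) (l : Fin N → 𝓛)
    (m m' : OrbitClass M l) [DecidableEq 𝓛] [∀ v p q, Decidable (IsInteracting m' m v p q)]
    [Decidable (m' = m)] :
    classDerivation D l m m' = if m' = m then classTrace D m' else
      ∑ v ∈ Finset.univ.image l, ∑ p : M v, ∑ q : M v,
        if IsInteracting m' m v p q then (countVec m ⟨v, q⟩ : 𝕜) * D v q p else 0 := by
  classical
  rw [classDerivation, Matrix.of_apply]
  split_ifs with hm
  · subst hm
    conv_rhs => rw [← orbitMk_orbitRep m']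
    change _ = ∑ j, D (l j) (orbitRep m' j) (orbitRep m' j)
    refine Finset.sum_congr rfl fun j _ => ?_
    have h1 : ∀ q, (orbitMk (replaceAt (orbitRep m') j q) = m') = (q = orbitRep m' j) :=
      fun q => by
        conv_lhs => rw [← orbitMk_orbitRep m']
        simp only [orbitMk_orbitRep]
        rw [← propext (orbitMk_replaceAt_eq_iff _ _ _), orbitMk_orbitRep]
    simp only [h1]
    simp
  · have hm' : m' ≠ orbitMk (orbitRep m) := by rwa [orbitMk_orbitRep]
    simp only [orbitMk_replaceAt_eq_iff_isInteracting _ _ _ hm']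
    rw [orbitMk_orbitRep]
    -- The contribution of a position j depends only on its pair (l_j, m_j). Grouping positions by
    -- pair produces the factor `countVec`.
    let G : (Σ v, M v) → 𝕜 := fun s =>
      ∑ q : M s.1, if IsInteracting m' m s.1 q s.2 then D s.1 s.2 q else 0
    have h2 : ∑ j, G (pairAt (orbitRep m) j)
        = ∑ s ∈ (Finset.univ.image l).sigma fun v => (Finset.univ : Finset (M v)),
          (countVec m s : 𝕜) * G s := by
      conv_rhs => rw [← orbitMk_orbitRep m, countVec_orbitMk]
      rw [← Finset.sum_fiberwise_of_maps_to (s := Finset.univ)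
        (t := (Finset.univ.image l).sigma fun v => (Finset.univ : Finset (M v)))
        (g := pairAt (orbitRep m)) (by simp [pairAt])]
      refine Finset.sum_congr rfl fun s _ => ?_
      rw [occurrences_eq_card, ← nsmul_eq_mul, ← Finset.sum_const]
      refine Finset.sum_congr rfl fun i hi => ?_
      rw [(Finset.mem_filter.1 hi).2]
    refine (Finset.sum_congr rfl fun j _ => Finset.sum_congr rfl fun q _ => by congr).trans
      (h2.trans ?_)
    rw [Finset.sum_sigma]
    refine Finset.sum_congr rfl fun v _ => ?_
    rw [Finset.sum_comm]
    refine Finset.sum_congr rfl fun q _ => ?_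
    rw [Finset.mul_sum]
    exact Finset.sum_congr rfl fun p _ => by rw [mul_ite, mul_zero]

/-- The block contains the transpose of `classDerivation`, because coefficients transform
contragrediently to the functions: its row m collects the terms that send m' to m. -/
theorem gepiBlock_mulVec (D : ∀ v, Matrix (M v) (M v) 𝕜) (l : Fin N → 𝓛) (L : 𝓛)
    (c : OrbitClass M l × M L → 𝕜) (m : OrbitClass M l) (k : M L) :
    (gepiBlock D l L).mulVec c (m, k)
      = ∑ m', c (m', k) * classDerivation D l m' m - ∑ k', D L k k' * c (m, k') := by
  classical
  rw [Matrix.mulVec, dotProduct, Fintype.sum_prod_type]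
  have h1 : ∀ m' k', gepiBlock D l L (m, k) (m', k') * c (m', k')
      = (if k' = k then c (m', k) * classDerivation D l m' m else 0)
        - if m' = m then D L k k' * c (m, k') else 0 := by
    intro m' k'
    rw [gepiBlock, Matrix.of_apply, classDerivation_eq]
    simp only [eq_comm (a := m) (b := m'), eq_comm (a := k) (b := k')]
    split_ifs with hm hk hk
    · subst hm hk; ring
    · subst hm; ring
    · subst hk; ring
    · ring
  simp only [h1, Finset.sum_sub_distrib]
  congr 1
  · exact Finset.sum_congr rfl fun m' _ => by simp
  · rw [Finset.sum_comm]
    exact Finset.sum_congr rfl fun k' _ => by simp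

end Derivative

/-! ### Equivariance as an intertwining relation -/

section Equivariance

variable {𝓛 : Type*} {M : 𝓛 → Type*} {N : ℕ} {Ω 𝕜 𝔽 : Type*} [Field 𝕜] [Field 𝔽] [Algebra 𝕜 𝔽]
  [∀ v, Fintype (M v)] {G : Type*} [Group G] [MulAction G Ω] {l : Fin N → 𝓛}

/-- The matrix whose columns are the coefficients of the classes. -/
def coeffMatrix {κ : Type*} (c : OrbitClass M l × κ → 𝕜) : Matrix κ (OrbitClass M l) 𝕜 :=
  Matrix.of fun k m => c (m, k)

theorem coeffFun_component_mem {κ : Type*} (φ : ∀ v, M v → Ω → 𝔽) (c : OrbitClass M l × κ → 𝕜)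
    (k : κ) : (fun R => coeffFun φ c R k) ∈ permInvSpace 𝕜 φ l := by
  rw [permInvSpace_eq_span_classProdSum]
  have h : (fun R => coeffFun φ c R k) = ∑ m, c (m, k) • classProdSum φ m := by
    funext R
    simp [coeffFun, Finset.sum_apply]
  rw [h]
  exact Submodule.sum_mem _ fun m _ => Submodule.smul_mem _ _ (Submodule.subset_span ⟨m, rfl⟩)

theorem exists_coeffFun_eq {κ : Type*} {φ : ∀ v, M v → Ω → 𝔽} {F : (Fin N → Ω) → κ → 𝔽}
    (hF : ∀ k, (fun R => F R k) ∈ permInvSpace 𝕜 φ l) :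
    ∃ c : OrbitClass M l × κ → 𝕜, coeffFun φ c = F := by
  simp only [permInvSpace_eq_span_classProdSum, Submodule.mem_span_range_iff_exists_fun] at hF
  choose c hc using hF
  refine ⟨fun s => c s.2 s.1, funext fun R => funext fun k => ?_⟩
  have := congrFun (hc k) R
  simpa [coeffFun, Finset.sum_apply] using this

theorem mem_ker_gepiMatrix_iff {ι : Type*} (D : ι → ∀ v, Matrix (M v) (M v) 𝕜) (L : 𝓛) (c : OrbitClass M l × M L → 𝕜) :
    c ∈ LinearMap.ker (gepiMatrix D l L).mulVecLin ↔
      ∀ d, coeffMatrix c * classDerivation (D d) l = D d L * coeffMatrix c := by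
  rw [LinearMap.mem_ker, Matrix.mulVecLin_apply, funext_iff]
  have h : ∀ d m k, (gepiMatrix D l L).mulVec c (d, (m, k))
      = (coeffMatrix c * classDerivation (D d) l) k m - (D d L * coeffMatrix c) k m :=
    fun d m k => gepiBlock_mulVec (D d) l L c m k
  simp only [Prod.forall, h, Pi.zero_apply, sub_eq_zero]
  refine forall_congr' fun d => ⟨fun h1 => ?_, fun h1 m k => by rw [h1]⟩
  ext k m
  exact h1 m k

variable [∀ v, DecidableEq (M v)] {ρ : ∀ v, G →* Matrix (M v) (M v) 𝕜} {φ : ∀ v, M v → Ω → 𝔽}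

/-- Comparing coefficients of the independent class functions avoids combinatorics with
representatives; multiplicativity follows in the same way. -/
theorem classAction_one [CharZero 𝔽]
    (hφ : LinearIndependent 𝔽 fun s : (Σ v, M v) => φ s.1 s.2) (l : Fin N → 𝓛) :
    classAction (fun v => (1 : Matrix (M v) (M v) 𝕜)) l = 1 := by
  funext m
  refine sum_smul_classProdSum_injective hφ fun R => ?_
  rw [← classProdSum_transform (φ' := φ) (R' := R) (by simp [Matrix.one_apply])]
  simp [Matrix.one_apply]

theorem classAction_mul [CharZero 𝔽]
    (hφ : LinearIndependent 𝔽 fun s : (Σ v, M v) => φ s.1 s.2)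
    (hφρ : ∀ (v : 𝓛) (p : M v) (g : G) (r : Ω), φ v p (g • r) = ∑ p', ρ v g p p' • φ v p' r)
    (l : Fin N → 𝓛) (g h : G) :
    classAction (fun v => ρ v (g * h)) l
      = classAction (fun v => ρ v g) l * classAction (fun v => ρ v h) l := by
  funext m
  refine sum_smul_classProdSum_injective hφ fun R => ?_
  have h1 : ∀ (g : G) (m : OrbitClass M l) (R : Fin N → Ω), classProdSum φ m (fun i => g • R i)
      = ∑ m', classAction (fun v => ρ v g) l m m' • classProdSum φ m' R :=
    fun g m R => classProdSum_transform (fun v p k => hφρ v p g (R k)) m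
  rw [← h1 (g * h)]
  simp only [mul_smul]
  rw [h1 g]
  simp only [h1 h, Matrix.mul_apply, Finset.smul_sum, Finset.sum_smul, smul_smul]
  exact Finset.sum_comm

theorem coeffFun_mem_gepiSpace_iff [CharZero 𝔽]
    (hφ : LinearIndependent 𝔽 fun s : (Σ v, M v) => φ s.1 s.2)
    (hφρ : ∀ (v : 𝓛) (p : M v) (g : G) (r : Ω), φ v p (g • r) = ∑ p', ρ v g p p' • φ v p' r)
    {κ : Type*} [Fintype κ] [DecidableEq κ] (τ : G →* Matrix κ κ 𝕜)
    (c : OrbitClass M l × κ → 𝕜) :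
    coeffFun φ c ∈ gepiSpace φ l τ ↔
      ∀ g, coeffMatrix c * classAction (fun v => ρ v g) l = τ g * coeffMatrix c := by
  have hleft : ∀ (R : Fin N → Ω) (g : G) (σ : Equiv.Perm (Fin N)) (k : κ),
      coeffFun φ c (fun i => g • R (σ i)) k
        = ∑ m, (coeffMatrix c * classAction (fun v => ρ v g) l) k m • classProdSum φ m R := by
    intro R g σ k
    have h1 : ∀ m : OrbitClass M l, classProdSum φ m (fun i => g • R (σ i))
        = ∑ m', classAction (fun v => ρ v g) l m m' • classProdSum φ m' R := by
      intro m
      rw [classProdSum_transform (R := fun i => R (σ i)) (fun v p k => hφρ v p g (R (σ k))) m]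
      simp only [classProdSum_comp_perm]
    simp only [coeffFun, h1, Matrix.mul_apply, Finset.smul_sum, Finset.sum_smul, smul_smul]
    exact Finset.sum_comm
  have hright : ∀ (R : Fin N → Ω) (g : G) (k : κ), ∑ k', τ g k k' • coeffFun φ c R k'
      = ∑ m, (τ g * coeffMatrix c) k m • classProdSum φ m R := by
    intro R g k
    simp only [coeffFun, Matrix.mul_apply, Finset.smul_sum, Finset.sum_smul, smul_smul]
    exact Finset.sum_comm
  constructor
  · rintro ⟨-, h⟩ g
    funext k
    refine sum_smul_classProdSum_injective hφ fun R => ?_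
    rw [← hleft R g 1, ← hright]
    exact h R g 1 k
  · intro h
    refine ⟨coeffFun_component_mem φ c, fun R g σ k => ?_⟩
    rw [hleft, hright, h]

/-- The group elements for which a matrix intertwines the action on the classes with `τ`. -/
def intertwiningSubgroup [CharZero 𝔽]
    (hφ : LinearIndependent 𝔽 fun s : (Σ v, M v) => φ s.1 s.2)
    (hφρ : ∀ (v : 𝓛) (p : M v) (g : G) (r : Ω), φ v p (g • r) = ∑ p', ρ v g p p' • φ v p' r)
    {κ : Type*} [Fintype κ] [DecidableEq κ] (τ : G →* Matrix κ κ 𝕜)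
    (C : Matrix κ (OrbitClass M l) 𝕜) : Subgroup G where
  carrier := {g | C * classAction (fun v => ρ v g) l = τ g * C}
  one_mem' := by
    simp only [Set.mem_ofPred_eq, map_one, classAction_one hφ, Matrix.mul_one, Matrix.one_mul]
  mul_mem' := by
    intro g h hg hh
    simp only [Set.mem_ofPred_eq] at hg hh ⊢
    rw [classAction_mul hφ hφρ, ← Matrix.mul_assoc, hg, Matrix.mul_assoc, hh, map_mul,
      Matrix.mul_assoc]
  inv_mem' := by
    intro g hg
    simp only [Set.mem_ofPred_eq] at hg ⊢
    have h1 : classAction (fun v => ρ v g) l * classAction (fun v => ρ v g⁻¹) l = 1 := by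
      rw [← classAction_mul hφ hφρ, mul_inv_cancel]
      simp only [map_one, classAction_one hφ]
    have h2 : τ g⁻¹ * τ g = 1 := by rw [← map_mul, inv_mul_cancel, map_one]
    calc C * classAction (fun v => ρ v g⁻¹) l
        = τ g⁻¹ * (τ g * C) * classAction (fun v => ρ v g⁻¹) l := by
          rw [← Matrix.mul_assoc, h2, Matrix.one_mul]
      _ = τ g⁻¹ * C := by
          rw [← hg, Matrix.mul_assoc, Matrix.mul_assoc, h1, Matrix.mul_one]

end Equivariance

/-! ### Reduction to the Lie algebra and conclusion -/

section LieReduction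

theorem continuous_classAction {𝓛 : Type*} {M : 𝓛 → Type*} {N : ℕ} {𝕜 G : Type*} [Field 𝕜]
    [TopologicalSpace 𝕜] [IsTopologicalRing 𝕜] [TopologicalSpace G] [∀ v, Fintype (M v)]
    {A : ∀ v, G → Matrix (M v) (M v) 𝕜} (hA : ∀ v, Continuous (A v)) (l : Fin N → 𝓛) :
    Continuous fun g => classAction (fun v => A v g) l := by
  refine continuous_matrix fun m m' => ?_
  refine continuous_finsetSum _ fun b _ => continuous_finsetProd _ fun i _ => ?_
  exact (hA (l i)).matrix_elem _ _

variable {n : ℕ} {G : Subgroup (GL (Fin n) ℂ)} {Ndim : ℕ} {X : Fin Ndim → linLieAlgebra G}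
    {𝕜 𝔽 : Type*} [RCLike 𝕜] [Field 𝔽] [Algebra 𝕜 𝔽]
    {Ω : Type*} [MulAction G Ω]
    {𝓛 : Type*} {M : 𝓛 → Type*} [∀ v, Fintype (M v)] [∀ v, DecidableEq (M v)]
    {φ : ∀ v, M v → Ω → 𝔽} {ρ : ∀ v, G →* Matrix (M v) (M v) 𝕜} {N : ℕ} {l : Fin N → 𝓛}

theorem forall_intertwines_iff_derivation (hGclosed : IsClosed (G : Set (GL (Fin n) ℂ)))
    (hGconn : IsConnected (G : Set (GL (Fin n) ℂ))) (hX : GeneratesLieAlgebra X) [CharZero 𝔽]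
    (hφ : LinearIndependent 𝔽 fun s : (Σ v, M v) => φ s.1 s.2) (hρ : ∀ v, Continuous (ρ v))
    (hφρ : ∀ (v : 𝓛) (p : M v) (g : G) (r : Ω), φ v p (g • r) = ∑ p', ρ v g p p' • φ v p' r)
    {κ : Type*} [Fintype κ] [DecidableEq κ] {τ : G →* Matrix κ κ 𝕜} (hτ : Continuous τ)
    (C : Matrix κ (OrbitClass M l) 𝕜) :
    (∀ g, C * classAction (fun v => ρ v g) l = τ g * C) ↔
      ∀ d, C * classDerivation (fun v => repDeriv (ρ v) (X d)) l = repDeriv τ (X d) * C := by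
  have hone : ∀ d, (∀ t, C * classAction (fun v => ρ v (lieExp (X d) t)) l
        = τ (lieExp (X d) t) * C) ↔
      C * classDerivation (fun v => repDeriv (ρ v) (X d)) l = repDeriv τ (X d) * C := fun d =>
    intertwines_iff_of_map_add C
      (U := fun t => classAction (fun v => ρ v (lieExp (X d) t)) l)
      (V := fun t => τ (lieExp (X d) t))
      (by simp only [lieExp_zero, map_one, classAction_one hφ])
      (fun s t => by simp only [lieExp_add]; exact classAction_mul hφ hφρ l _ _)
      (hasDerivAt_classAction (fun v => by simp)
        fun v => hasDerivAt_repDeriv (hρ v) (X d))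
      (by simp) (fun s t => by rw [lieExp_add, map_mul]) (hasDerivAt_repDeriv hτ (X d))
  constructor
  · exact fun h d => (hone d).1 fun t => h _
  · intro h g
    have hclosed : IsClosed (intertwiningSubgroup hφ hφρ τ C : Set G) :=
      isClosed_eq (continuous_const.matrix_mul (continuous_classAction hρ l))
        (hτ.matrix_mul continuous_const)
    exact mem_of_generatesLieAlgebra hGclosed hGconn hX hclosed
      (fun d t => (hone d).2 (h d) t) g

end LieReduction

theorem mainTheorem1
    -- the connected linear Lie group and its generators
    {n : ℕ} (G : Subgroup (GL (Fin n) ℂ)) (hGclosed : IsClosed (G : Set (GL (Fin n) ℂ)))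
    (hGconn : IsConnected (G : Set (GL (Fin n) ℂ)))
    {Ndim : ℕ} (X : Fin Ndim → linLieAlgebra G)
    (hX : GeneratesLieAlgebra X)
    -- the scalars, the domain with its group action, the one-particle basis functions
    {𝕜 𝔽 : Type*} [RCLike 𝕜] [Field 𝔽] [Algebra 𝕜 𝔽]
    {Ω : Type*} [MulAction G Ω]
    {𝓛 : Type*} {M : 𝓛 → Type*} [∀ v, Fintype (M v)] [∀ v, DecidableEq (M v)]
    (φ : ∀ v, M v → Ω → 𝔽)
    (hφ : LinearIndependent 𝔽 fun s : (Σ v, M v) => φ s.1 s.2)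
    -- compatibility with continuous representations
    (ρ : ∀ v, G →* Matrix (M v) (M v) 𝕜) (hρ : ∀ v, Continuous (ρ v))
    (hφρ : ∀ (v : 𝓛) (p : M v) (g : G) (r : Ω), φ v p (g • r) = ∑ p', ρ v g p p' • φ v p' r)
    {N : ℕ} (l : Fin N → 𝓛) (L : 𝓛) :
    let K := LinearMap.ker (gepiMatrix (fun d v => repDeriv (ρ v) (X d)) l L).mulVecLin
    (∀ c : OrbitClass M l × M L → 𝕜, coeffFun φ c ∈ gepiSpace φ l (ρ L) ↔ c ∈ K) ∧
    (∀ c : Module.Basis (Fin (Module.finrank 𝕜 K)) 𝕜 K,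
      ∃ b : Module.Basis (Fin (Module.finrank 𝕜 K)) 𝕜 (gepiSpace φ l (ρ L)),
        ∀ i, (b i : (Fin N → Ω) → M L → 𝔽) = coeffFun φ (c i : OrbitClass M l × M L → 𝕜)) ∧
    Module.Finite 𝕜 (gepiSpace φ l (ρ L)) ∧
    Module.finrank 𝕜 (gepiSpace φ l (ρ L)) = Module.finrank 𝕜 K := by
  intro K
  have : CharZero 𝔽 := charZero_of_injective_algebraMap (algebraMap 𝕜 𝔽).injective
  have hmem : ∀ c : OrbitClass M l × M L → 𝕜, coeffFun φ c ∈ gepiSpace φ l (ρ L) ↔ c ∈ K :=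
    fun c => by
      rw [coeffFun_mem_gepiSpace_iff hφ hφρ, mem_ker_gepiMatrix_iff,
        forall_intertwines_iff_derivation hGclosed hGconn hX hφ hρ hφρ (hρ L)]
  -- The map c ↦ F_c is injective by independence of the class functions, and surjective because
  -- they span the space of the components.
  let f : K →ₗ[𝕜] gepiSpace φ l (ρ L) :=
    { toFun := fun c => ⟨coeffFun φ c.1, (hmem c.1).2 c.2⟩
      map_add' := fun c c' => Subtype.ext <| funext fun R => funext fun k => by
        simp [coeffFun, add_smul, Finset.sum_add_distrib]
      map_smul' := fun a c => Subtype.ext <| funext fun R => funext fun k => by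
        simp [coeffFun, mul_smul, Finset.smul_sum] }
  have hf : Function.Bijective f := by
    constructor
    · intro c c' h
      have h1 : coeffFun φ c.1 = coeffFun φ c'.1 := congrArg Subtype.val h
      refine Subtype.ext (funext fun s => ?_)
      exact congrFun (sum_smul_classProdSum_injective hφ
        (c := fun m => c.1 (m, s.2)) (c' := fun m => c'.1 (m, s.2))
        fun R => congrFun (congrFun h1 R) s.2) s.1
    · rintro ⟨F, hF⟩
      obtain ⟨c, rfl⟩ := exists_coeffFun_eq hF.1
      exact ⟨⟨c, (hmem c).1 hF⟩, rfl⟩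
  let e := LinearEquiv.ofBijective f hf
  exact ⟨hmem, fun c => ⟨c.map e, fun i => by rw [Module.Basis.map_apply]; rfl⟩,
    Module.Finite.equiv e, e.symm.finrank_eq⟩
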